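/- Let $n\ge 1$ be an integer and let $m>2$ be an even integer. On $\mathbb R\times\mathbb R^n$, with points $x=(x^0,\bar x)$ and tangent vectors $y=(y^0,\bar y)$, put $\alpha=|\bar y|$, $z=y^0/|\bar y|$, $\rho=|\bar x|$, and for a function $\varphi(z,\rho)$ consider the (squared) metric $L=F^2=\alpha^2\varphi(z,\rho)$. Its fundamental tensor is $g_{AB}=\tfrac12[L]_{y^Ay^B}$, its spray coefficients are $G^C=\tfrac14 g^{CA}\big([L]_{y^Ax^B}y^B-[L]_{x^A}\big)$, and its Ricci curvature is $\mathrm{Ric}=\sum_A K_A^A$, where $$K_B^C=2[G^C]_{x^B}-[G^C]_{x^Ay^B}y^A+2G^A[G^C]_{y^Ay^B}-[G^C]_{y^A}[G^A]_{y^B}.$$ For a set $I\subseteq(0,\infty)$ let $D_I$ be the set of all $(x,y)$ with $|\bar x|\in I$, $y^0\ne0$, $\bar y\neq0$ and $\varphi(z,\rho)\ne0$. "Ricci-flat over $I$" means $\mathrm{Ric}=0$ on $D_I$; "non-Riemannian over $I$" means that near no $(x,y)\in D_I$ is the tensor $g_{AB}(x,\cdot)$ locally independent of the direction $y$; "positive-definite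 Finsler metric over $I$" means that $D_I$ is open and invariant under $y\mapsto cy$, $c>0$, that $L$ is smooth, positive and positively homogeneous of degree $2$ in $y$ on $D_I$, and that $(g_{AB})$ is positive definite on $D_I$; "Lorentzian metric over $I$" means the same without positivity of $L$ and with $(g_{AB})$ of signature $(+,-,\dots,-)$. **(1) Positive-definite case.** Let $I\subseteq(0,\infty)$ be a nonempty open interval, let $f,g\in C^\infty(I)$, and let $$\varphi(z,\rho)=\big(e^{f(\rho)}z^m+e^{g(\rho)}\big)^{2/m}.$$ Then $F=\alpha\sqrt{\varphi}$ is a positive-definite, non-Riemannian Finsler metric over $I$, and: * if $n\ge3$, it is Ricci-flat over $I$ if and only if $f$ is constant on $I$ and either $g$ is constant on $I$ or $g(\rho)=\ln(B\rho^{-2m})$ on $I$ for some constant $B>0$; * if $n=2$, it is Ricci-flat over $I$ if and only if $f$ is constant on $I$ and $g(\rho)=\ln(B\rho^{C})$ on $I$ for some constants $B>0$, $C\in\mathbb R$; * if $n=1$, it is Ricci-flat over $I$ if and only if $f$ is constant on $I$ ($g$ being arbitrary). In particular, for all constants $A,B>0$ the following functions give positive-definite, non-Riemannian, Ricci-flat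 Finsler metrics: * $\varphi=(Az^m+B)^{2/m}$ over $(0,\infty)$, for every $n\ge1$; * $\varphi=(Az^m+B\rho^{-2m})^{2/m}$ over $(0,\infty)$, for $n\ge3$; * $\varphi=(Az^m+B\rho^{C})^{2/m}$ over $(0,\infty)$, for $n=2$ and every $C\in\mathbb R$; * $\varphi=(Az^m+B|\rho^2+C|^{-m})^{2/m}$ over $\{\rho>0:\rho^2+C\ne0\}$, for $n=1$ and every $C\in\mathbb R$. **(2) Lorentzian case.** Suppose moreover that $m\equiv2\pmod 4$, and for $s\in\mathbb R$ let $s^{2/m}$ denote the real $(m/2)$-th root of $s$. Then everything in (1) remains true when $\varphi$ is replaced by $\big(e^{f(\rho)}z^m-e^{g(\rho)}\big)^{2/m}$ (and, in the explicit families, $Az^m+\cdots$ by $Az^m-\cdots$) and "positive-definite Finsler metric" by "Lorentzian metric" $L=\alpha^2\varphi$: the same criteria for Ricci-flatness hold for $n\ge3$, $n=2$, $n=1$, and the corresponding explicit families are non-Riemannian and Ricci-flat of signature $(+,-,\dots,-)$. -/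

import Mathlib

open Set Topology
open scoped ContDiff

namespace WarpedFinsler

noncomputable section

/-- Points `x = (x⁰, x¹, …, xⁿ)` of `ℝ × ℝⁿ`, and also tangent vectors `y = (y⁰, y¹, …, yⁿ)`. -/
abbrev Coord (n : ℕ) : Type := Fin (n + 1) → ℝ

/-- A function of position `x` and direction `y`, i.e. a function on (part of) the tangent bundle
of `ℝ × ℝⁿ`. -/
abbrev TFun (n : ℕ) : Type := Coord n → Coord n → ℝ

/-- The Euclidean norm of the spatial part `(v¹, …, vⁿ)` of `v`. -/
def spatialNorm {n : ℕ} (v : Coord n) : ℝ := √(∑ i : Fin n, v i.succ ^ 2)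

/-- The squared metric `L = F² = α² φ(z, ρ)` with `α = |ȳ|`, `z = y⁰ / |ȳ|`, `ρ = |x̄|`. -/
def warped {n : ℕ} (φ : ℝ → ℝ → ℝ) : TFun n := fun x y =>
  spatialNorm y ^ 2 * φ (y 0 / spatialNorm y) (spatialNorm x)

/-- The partial derivative `∂H / ∂x^A`. -/
def dX {n : ℕ} (H : TFun n) (A : Fin (n + 1)) : TFun n := fun x y =>
  lineDeriv ℝ (fun x' => H x' y) x (Pi.single A 1)

/-- The partial derivative `∂H / ∂y^A`. -/
def dY {n : ℕ} (H : TFun n) (A : Fin (n + 1)) : TFun n := fun x y =>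
  lineDeriv ℝ (fun y' => H x y') y (Pi.single A 1)

/-- The fundamental tensor `g_{AB} = ½ [L]_{y^A y^B}` of `L = F²`. -/
def fundTensor {n : ℕ} (L : TFun n) (x y : Coord n) : Matrix (Fin (n + 1)) (Fin (n + 1)) ℝ :=
  Matrix.of fun A B => 1 / 2 * dY (dY L A) B x y

/-- The spray coefficients `G^C = ¼ g^{CA} ([L]_{y^A x^B} y^B - [L]_{x^A})`. -/
def spray {n : ℕ} (L : TFun n) (C : Fin (n + 1)) : TFun n := fun x y =>
  1 / 4 * ∑ A, (fundTensor L x y)⁻¹ C A * ((∑ B, dX (dY L A) B x y * y B) - dX L A x y)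

/-- Berwald's formula for the flag curvature tensor (Riemann curvature)
`K_B^C = 2 [G^C]_{x^B} - [G^C]_{x^A y^B} y^A + 2 G^A [G^C]_{y^A y^B} - [G^C]_{y^A} [G^A]_{y^B}`. -/
def flagCurvature {n : ℕ} (L : TFun n) (B C : Fin (n + 1)) : TFun n := fun x y =>
  2 * dX (spray L C) B x y
    - ∑ A, dY (dX (spray L C) A) B x y * y A
    + 2 * ∑ A, spray L A x y * dY (dY (spray L C) A) B x y
    - ∑ A, dY (spray L C) A x y * dY (spray L A) B x y

/-- The Ricci curvature `Ric = ∑_A K_A^A`. -/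
def ricci {n : ℕ} (L : TFun n) : TFun n := fun x y => ∑ A, flagCurvature L A A x y

/-- `Ric = 0` at every point of a part `D` of the tangent bundle. -/
def RicciFlatOn {n : ℕ} (D : Set (Coord n × Coord n)) (L : TFun n) : Prop :=
  ∀ p ∈ D, ricci L p.1 p.2 = 0

/-- What positive-definite and Lorentzian metrics have in common: `L` is smooth on `D`, and `D` is
a cone in the directions, on which `L` is positively homogeneous of degree two. -/
structure IsHomogeneousOn {n : ℕ} (D : Set (Coord n × Coord n)) (L : TFun n) : Prop where
  isOpen : IsOpen D
  smooth : ContDiffOn ℝ ∞ (fun p : Coord n × Coord n => L p.1 p.2) D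
  cone : ∀ p ∈ D, ∀ c : ℝ, 0 < c → (p.1, c • p.2) ∈ D
  homogeneous : ∀ p ∈ D, ∀ c : ℝ, 0 < c → L p.1 (c • p.2) = c ^ 2 * L p.1 p.2

/-- `F = √L` is a positive-definite (strongly convex) Finsler metric on `D`. -/
structure IsFinslerOn {n : ℕ} (D : Set (Coord n × Coord n)) (L : TFun n) : Prop extends
    IsHomogeneousOn D L where
  pos : ∀ p ∈ D, 0 < L p.1 p.2
  posDef : ∀ p ∈ D, (fundTensor L p.1 p.2).PosDef

/-- `L` is a Finsler metric of Lorentz signature `(+, -, …, -)` on `D`. -/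
structure IsLorentzOn {n : ℕ} (D : Set (Coord n × Coord n)) (L : TFun n) : Prop extends
    IsHomogeneousOn D L where
  symm : ∀ p ∈ D, (fundTensor L p.1 p.2).IsSymm
  sigPos_eq : ∀ p ∈ D, sigPos (fundTensor L p.1 p.2).toQuadraticForm' = 1
  sigNeg_eq : ∀ p ∈ D, sigNeg (fundTensor L p.1 p.2).toQuadraticForm' = n

/-- `L` is nowhere Riemannian on `D`: around no `(x, y) ∈ D` is the fundamental tensor at `x`
independent of the direction, even locally. -/
def NonRiemannianOn {n : ℕ} (D : Set (Coord n × Coord n)) (L : TFun n) : Prop :=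
  ∀ p ∈ D, ¬ ∀ᶠ y in 𝓝 p.2, fundTensor L p.1 y = fundTensor L p.1 p.2

/-- The `(x, y)` with `|x̄| ∈ I`, `y⁰ ≠ 0`, `ȳ ≠ 0` and `φ(z, ρ) ≠ 0`: the part of the tangent
bundle over `{|x̄| ∈ I}` where an `m`-th root metric is smooth and non-degenerate. -/
def regularDomain (n : ℕ) (I : Set ℝ) (φ : ℝ → ℝ → ℝ) : Set (Coord n × Coord n) :=
  {p | spatialNorm p.1 ∈ I ∧ p.2 0 ≠ 0 ∧ spatialNorm p.2 ≠ 0 ∧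
    φ (p.2 0 / spatialNorm p.2) (spatialNorm p.1) ≠ 0}

/-- The positive-definite `m`-th root ansatz `φ = (a(ρ) z^m + b(ρ))^{2/m}`. -/
def rootPhi (m : ℕ) (a b : ℝ → ℝ) : ℝ → ℝ → ℝ := fun z ρ =>
  (a ρ * z ^ m + b ρ) ^ (2 / m : ℝ)

/-- The Lorentzian `m`-th root ansatz `φ = (a(ρ) z^m - b(ρ))^{2/m}`, for `m ≡ 2 (mod 4)`. There
`m / 2` is odd, and `s^{2/m}` is the real `(m/2)`-th root `sign(s) |s|^{2/m}` of `s ∈ ℝ`. -/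
def lorentzPhi (m : ℕ) (a b : ℝ → ℝ) : ℝ → ℝ → ℝ := fun z ρ =>
  Real.sign (a ρ * z ^ m - b ρ) * |a ρ * z ^ m - b ρ| ^ (2 / m : ℝ)

/-- `h` is constant on `I`. -/
def IsConstOn (h : ℝ → ℝ) (I : Set ℝ) : Prop := ∃ c : ℝ, ∀ ρ ∈ I, h ρ = c

/-- `φ` yields a positive-definite, nowhere Riemannian, Ricci-flat Finsler metric `α √φ`
over `{|x̄| ∈ I}`. -/
structure IsRicciFlatFinsler (n : ℕ) (I : Set ℝ) (φ : ℝ → ℝ → ℝ) : Prop where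
  finsler : IsFinslerOn (regularDomain n I φ) (warped φ)
  nonRiemannian : NonRiemannianOn (regularDomain n I φ) (warped φ)
  ricciFlat : RicciFlatOn (regularDomain n I φ) (warped φ)

/-- `φ` yields a nowhere Riemannian, Ricci-flat Finsler metric `α² φ` of signature `(+, -, …, -)`
over `{|x̄| ∈ I}`. -/
structure IsRicciFlatLorentz (n : ℕ) (I : Set ℝ) (φ : ℝ → ℝ → ℝ) : Prop where
  lorentz : IsLorentzOn (regularDomain n I φ) (warped φ)
  nonRiemannian : NonRiemannianOn (regularDomain n I φ) (warped φ)
  ricciFlat : RicciFlatOn (regularDomain n I φ) (warped φ)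

end

end WarpedFinsler

/-! Write m = 2j + 4 and L = S^{2/m}, where S = a(ρ) u^m + b(ρ) N^{m/2}, u = y⁰, N = |ȳ|², a > 0, b
≠ 0. The positive-definite ansatz is b > 0 and the Lorentzian one is b < 0. With the odd extension
`signedPow` of the power, whose derivative is even and positive, both are one object,
`IsRootMetric`, and share all curvature computations.

Metric. The fundamental tensor is θ/2 · (S_YY − ((m−2)/m) S_Y ⊗ S_Y / S) with θ > 0. Completing
squares (`rootForm_eq_sum_squares`) splits it into two rank-one squares and a Cauchy–Schwarz defect,
and the signs of b and S give the signature. Its (0,i) component is a nonconstant function of u, so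
the metric is nowhere Riemannian.

Spray. The Euler–Lagrange equations of S are solved explicitly, and their solution is also the spray
of L (`spray_eq`). Its coefficients are λ = a'/(2(m−1)aρ), μ = b'/(mbρ) and κ = a'/(2bρ).

Curvature. Besides ρ, t = ⟨x̄,ȳ⟩ and N, the Ricci curvature involves only Z = u^m/N^{m/2}, in which
it is quadratic (`ricci_eq`). For y with spatial part parallel to x̄, the coefficient of Z² is a
nonzero multiple of κ² because m > 2. Letting Z vary forces κ = 0, so a' = 0 (`deriv_a_eq_zero`).

Once a' = 0, G⁰ vanishes and the Gⁱ form the spray of the conformally flat metric |b|^{2/m}|dx̄|² on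
ℝⁿ, so the condition is that this radial metric be Ricci-flat. For n = 1 this is automatic. For n =
2 it says that log|b| is harmonic, hence affine in log ρ. For n ≥ 3 the metric must be flat: either
b is constant, or the conformal factor is a multiple of ρ⁻⁴, that of the inversion, which means b is
a multiple of ρ^{−2m}. In the proof these cases come from (ρ²μ)' = 0 and, for n ≥ 3, c(c+2) = 0 for
the constant c = ρ²μ (`rootMu_equations`). -/

namespace WarpedFinsler

noncomputable section

/-! ### Line derivatives -/

section LineDeriv
variable {E : Type*} [AddCommGroup E] [Module ℝ E] {f g : E → ℝ} {f' g' : ℝ} {x v : E}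

lemma lineDerivAt_congr (hf : HasLineDerivAt ℝ f f' x v) (h : f' = g') :
    HasLineDerivAt ℝ f g' x v :=
  h ▸ hf

lemma lineDerivAt_add (hf : HasLineDerivAt ℝ f f' x v) (hg : HasLineDerivAt ℝ g g' x v) :
    HasLineDerivAt ℝ (fun x => f x + g x) (f' + g') x v :=
  HasDerivAt.add hf hg

lemma lineDerivAt_sub (hf : HasLineDerivAt ℝ f f' x v) (hg : HasLineDerivAt ℝ g g' x v) :
    HasLineDerivAt ℝ (fun x => f x - g x) (f' - g') x v :=
  HasDerivAt.sub hf hg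

lemma lineDerivAt_mul (hf : HasLineDerivAt ℝ f f' x v) (hg : HasLineDerivAt ℝ g g' x v) :
    HasLineDerivAt ℝ (fun x => f x * g x) (f' * g x + f x * g') x v := by
  simpa [HasLineDerivAt] using! HasDerivAt.mul hf hg

lemma lineDerivAt_const (c : ℝ) : HasLineDerivAt ℝ (fun _ : E => c) 0 x v :=
  hasDerivAt_const _ _

lemma lineDerivAt_const_mul (c : ℝ) (hf : HasLineDerivAt ℝ f f' x v) :
    HasLineDerivAt ℝ (fun x => c * f x) (c * f') x v :=
  HasDerivAt.const_mul c hf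

lemma lineDerivAt_mul_const (c : ℝ) (hf : HasLineDerivAt ℝ f f' x v) :
    HasLineDerivAt ℝ (fun x => f x * c) (f' * c) x v :=
  HasDerivAt.mul_const hf c

lemma lineDerivAt_comp {h : ℝ → ℝ} {h' : ℝ} (hh : HasDerivAt h h' (f x))
    (hf : HasLineDerivAt ℝ f f' x v) : HasLineDerivAt ℝ (fun x => h (f x)) (h' * f') x v := by
  have hf' : HasDerivAt (fun s : ℝ => f (x + s • v)) f' 0 := hf
  exact HasDerivAt.comp (h := fun s : ℝ => f (x + s • v)) (h₂ := h) (0 : ℝ) (by simpa using hh) hf'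

lemma lineDerivAt_pow (k : ℕ) (hf : HasLineDerivAt ℝ f f' x v) :
    HasLineDerivAt ℝ (fun x => f x ^ k) (k * f x ^ (k - 1) * f') x v :=
  lineDerivAt_comp (hasDerivAt_pow k (f x)) hf

lemma lineDerivAt_div (hf : HasLineDerivAt ℝ f f' x v) (hg : HasLineDerivAt ℝ g g' x v)
    (h : g x ≠ 0) :
    HasLineDerivAt ℝ (fun x => f x / g x) ((f' * g x - f x * g') / g x ^ 2) x v := by
  simpa [HasLineDerivAt] using! HasDerivAt.div hf hg (by simpa using h)

end LineDeriv

/-! ### The spatial inner product -/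

variable {n : ℕ}

/-- The Euclidean inner product of the spatial parts. -/
def sdot (v w : Coord n) : ℝ := ∑ i : Fin n, v i.succ * w i.succ

/-- The standard basis of `ℝ × ℝⁿ`. -/
abbrev std (A : Fin (n + 1)) : Coord n := Pi.single A 1

lemma sdot_comm (v w : Coord n) : sdot v w = sdot w v := by
  simp [sdot, mul_comm]

lemma sdot_add_left (v w z : Coord n) : sdot (v + w) z = sdot v z + sdot w z := by
  simp [sdot, add_mul, Finset.sum_add_distrib]

lemma sdot_smul_left (c : ℝ) (v w : Coord n) : sdot (c • v) w = c * sdot v w := by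
  simp [sdot, Finset.mul_sum, mul_assoc]

lemma sdot_add_right (v w z : Coord n) : sdot z (v + w) = sdot z v + sdot z w := by
  rw [sdot_comm, sdot_add_left, sdot_comm v, sdot_comm w]

lemma sdot_smul_right (c : ℝ) (v w : Coord n) : sdot v (c • w) = c * sdot v w := by
  rw [sdot_comm, sdot_smul_left, sdot_comm]

lemma sdot_self_nonneg (v : Coord n) : 0 ≤ sdot v v :=
  Finset.sum_nonneg fun _ _ => mul_self_nonneg _

@[simp] lemma sdot_std_zero (v : Coord n) : sdot v (std 0) = 0 := by
  simp [sdot]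

@[simp] lemma sdot_std_succ (v : Coord n) (i : Fin n) : sdot v (std i.succ) = v i.succ := by
  simp [sdot, Pi.single_apply]

@[simp] lemma std_zero_sdot (v : Coord n) : sdot (std 0) v = 0 := by
  rw [sdot_comm, sdot_std_zero]

@[simp] lemma std_succ_sdot (v : Coord n) (i : Fin n) : sdot (std i.succ) v = v i.succ := by
  rw [sdot_comm, sdot_std_succ]

@[simp] lemma std_succ_apply_zero (i : Fin n) : std i.succ 0 = 0 := by
  simp

lemma sum_std_zero_mul (w : Coord n) : ∑ A, std A 0 * w A = w 0 := by
  simp [Fin.sum_univ_succ]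

lemma sum_sdot_std_mul (v w : Coord n) : ∑ A, sdot v (std A) * w A = sdot v w := by
  simp [Fin.sum_univ_succ]
  rfl

lemma spatialNorm_eq_sqrt (v : Coord n) : spatialNorm v = √(sdot v v) := by
  simp [spatialNorm, sdot, pow_two]

lemma spatialNorm_sq (v : Coord n) : spatialNorm v ^ 2 = sdot v v := by
  rw [spatialNorm_eq_sqrt, Real.sq_sqrt (sdot_self_nonneg v)]

lemma spatialNorm_nonneg (v : Coord n) : 0 ≤ spatialNorm v := Real.sqrt_nonneg _

lemma spatialNorm_smul {c : ℝ} (hc : 0 ≤ c) (v : Coord n) :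
    spatialNorm (c • v) = c * spatialNorm v := by
  rw [spatialNorm_eq_sqrt, spatialNorm_eq_sqrt, sdot_smul_left, sdot_smul_right, ← mul_assoc,
    Real.sqrt_mul (mul_self_nonneg c), Real.sqrt_mul_self hc]

lemma contDiff_sdot {k : ℕ∞ω} {E : Type*} [NormedAddCommGroup E] [NormedSpace ℝ E]
    {f g : E → Coord n} (hf : ContDiff ℝ k f) (hg : ContDiff ℝ k g) :
    ContDiff ℝ k (fun p => sdot (f p) (g p)) := by
  unfold sdot
  fun_prop

lemma lineDerivAt_apply (x v : Coord n) (A : Fin (n + 1)) :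
    HasLineDerivAt ℝ (fun x : Coord n => x A) (v A) x v := by
  simpa [HasLineDerivAt] using
    ((hasDerivAt_id (0 : ℝ)).mul_const (v A)).const_add (x A)

lemma lineDerivAt_sdot_left (x v w : Coord n) :
    HasLineDerivAt ℝ (fun x : Coord n => sdot x w) (sdot v w) x v := by
  simpa [HasLineDerivAt, sdot_add_left, sdot_smul_left] using
    ((hasDerivAt_id (0 : ℝ)).mul_const (sdot v w)).const_add (sdot x w)

lemma lineDerivAt_sdot_right (x v w : Coord n) :
    HasLineDerivAt ℝ (fun x : Coord n => sdot w x) (sdot w v) x v := by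
  simpa only [sdot_comm w] using lineDerivAt_sdot_left x v w

lemma lineDerivAt_sdot_self (x v : Coord n) :
    HasLineDerivAt ℝ (fun x : Coord n => sdot x x) (2 * sdot x v) x v := by
  have h : HasLineDerivAt ℝ (fun x : Coord n => sdot x x)
      (∑ i : Fin n, (v i.succ * x i.succ + x i.succ * v i.succ)) x v := by
    unfold HasLineDerivAt sdot
    exact HasDerivAt.fun_sum fun i _ =>
      lineDerivAt_mul (lineDerivAt_apply x v i.succ) (lineDerivAt_apply x v i.succ)
  convert h using 1
  rw [sdot, Finset.mul_sum]
  exact Finset.sum_congr rfl fun i _ => by ring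

lemma lineDerivAt_spatialNorm {x : Coord n} (hx : spatialNorm x ≠ 0) (v : Coord n) :
    HasLineDerivAt ℝ (fun x : Coord n => spatialNorm x) (sdot x v / spatialNorm x) x v := by
  have h0 : sdot x x ≠ 0 := by rw [← spatialNorm_sq]; positivity
  have := lineDerivAt_comp (f := fun x : Coord n => sdot x x) (Real.hasDerivAt_sqrt h0)
    (lineDerivAt_sdot_self x v)
  simp only [← spatialNorm_eq_sqrt] at this
  convert this using 1
  field_simp

lemma contDiffAt_spatialNorm {k : ℕ∞ω} {x : Coord n} (hx : spatialNorm x ≠ 0) :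
    ContDiffAt ℝ k (fun x : Coord n => spatialNorm x) x := by
  have h0 : sdot x x ≠ 0 := by rw [← spatialNorm_sq]; positivity
  simp only [spatialNorm_eq_sqrt]
  exact (contDiff_sdot contDiff_id contDiff_id).contDiffAt.sqrt h0

lemma continuous_spatialNorm : Continuous (spatialNorm : Coord n → ℝ) := by
  unfold spatialNorm
  fun_prop

/-! ### Partial derivatives on the tangent bundle -/

lemma dX_eq_of {H : TFun n} {A : Fin (n + 1)} {x y : Coord n} {d : ℝ}
    (h : HasLineDerivAt ℝ (fun x' => H x' y) d x (std A)) : dX H A x y = d :=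
  h.lineDeriv

lemma dY_eq_of {H : TFun n} {A : Fin (n + 1)} {x y : Coord n} {d : ℝ}
    (h : HasLineDerivAt ℝ (fun y' => H x y') d y (std A)) : dY H A x y = d :=
  h.lineDeriv

lemma eventually_mem_left {D : Set (Coord n × Coord n)} (hD : IsOpen D) {x y : Coord n}
    (h : (x, y) ∈ D) : ∀ᶠ x' in 𝓝 x, (x', y) ∈ D :=
  (Continuous.prodMk_left y).continuousAt.preimage_mem_nhds (hD.mem_nhds h)

lemma eventually_mem_right {D : Set (Coord n × Coord n)} (hD : IsOpen D) {x y : Coord n}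
    (h : (x, y) ∈ D) : ∀ᶠ y' in 𝓝 y, (x, y') ∈ D :=
  (Continuous.prodMk_right x).continuousAt.preimage_mem_nhds (hD.mem_nhds h)

variable {D : Set (Coord n × Coord n)}

lemma dX_congr (hD : IsOpen D) {H K : TFun n} (h : ∀ x y, (x, y) ∈ D → H x y = K x y)
    (A : Fin (n + 1)) : ∀ x y, (x, y) ∈ D → dX H A x y = dX K A x y := by
  intro x y hp
  apply Filter.EventuallyEq.lineDeriv_eq
  filter_upwards [eventually_mem_left hD hp] with x' hx' using h _ _ hx'

lemma dY_congr (hD : IsOpen D) {H K : TFun n} (h : ∀ x y, (x, y) ∈ D → H x y = K x y)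
    (A : Fin (n + 1)) : ∀ x y, (x, y) ∈ D → dY H A x y = dY K A x y := by
  intro x y hp
  apply Filter.EventuallyEq.lineDeriv_eq
  filter_upwards [eventually_mem_right hD hp] with x' hx' using h _ _ hx'

lemma lineDerivAt_dX {H : TFun n} {x y : Coord n}
    (h : DifferentiableAt ℝ (fun p : Coord n × Coord n => H p.1 p.2) (x, y)) (A : Fin (n + 1)) :
    HasLineDerivAt ℝ (fun x' => H x' y)
      (fderiv ℝ (fun p : Coord n × Coord n => H p.1 p.2) (x, y) (std A, 0)) x (std A) := by
  have := h.hasFDerivAt.hasLineDerivAt (std A, 0)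
  simpa [HasLineDerivAt] using! this

lemma lineDerivAt_dY {H : TFun n} {x y : Coord n}
    (h : DifferentiableAt ℝ (fun p : Coord n × Coord n => H p.1 p.2) (x, y)) (A : Fin (n + 1)) :
    HasLineDerivAt ℝ (fun y' => H x y')
      (fderiv ℝ (fun p : Coord n × Coord n => H p.1 p.2) (x, y) (0, std A)) y (std A) := by
  have := h.hasFDerivAt.hasLineDerivAt (0, std A)
  simpa [HasLineDerivAt] using! this

lemma differentiableAt_of_smooth (hD : IsOpen D) {H : TFun n}
    (h : ContDiffOn ℝ ∞ (fun p : Coord n × Coord n => H p.1 p.2) D) {x y : Coord n}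
    (hp : (x, y) ∈ D) : DifferentiableAt ℝ (fun p : Coord n × Coord n => H p.1 p.2) (x, y) :=
  (h.contDiffAt (hD.mem_nhds hp)).differentiableAt (by simp)

lemma dX_eq_fderiv (hD : IsOpen D) {H : TFun n}
    (h : ContDiffOn ℝ ∞ (fun p : Coord n × Coord n => H p.1 p.2) D) (A : Fin (n + 1)) :
    ∀ p ∈ D, dX H A p.1 p.2 =
      fderiv ℝ (fun p : Coord n × Coord n => H p.1 p.2) p (std A, 0) :=
  fun _ hp => dX_eq_of (lineDerivAt_dX (differentiableAt_of_smooth hD h hp) A)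

lemma dY_eq_fderiv (hD : IsOpen D) {H : TFun n}
    (h : ContDiffOn ℝ ∞ (fun p : Coord n × Coord n => H p.1 p.2) D) (A : Fin (n + 1)) :
    ∀ p ∈ D, dY H A p.1 p.2 =
      fderiv ℝ (fun p : Coord n × Coord n => H p.1 p.2) p (0, std A) :=
  fun _ hp => dY_eq_of (lineDerivAt_dY (differentiableAt_of_smooth hD h hp) A)

lemma contDiffOn_fderiv_apply (hD : IsOpen D) {F : Coord n × Coord n → ℝ}
    (h : ContDiffOn ℝ ∞ F D) (w : Coord n × Coord n) :
    ContDiffOn ℝ ∞ (fun p => fderiv ℝ F p w) D :=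
  (h.fderiv_of_isOpen hD (m := ∞) (by simp)).clm_apply contDiffOn_const

lemma smooth_dX (hD : IsOpen D) {H : TFun n}
    (h : ContDiffOn ℝ ∞ (fun p : Coord n × Coord n => H p.1 p.2) D) (A : Fin (n + 1)) :
    ContDiffOn ℝ ∞ (fun p : Coord n × Coord n => dX H A p.1 p.2) D :=
  (contDiffOn_fderiv_apply hD h _).congr (dX_eq_fderiv hD h A)

lemma smooth_dY (hD : IsOpen D) {H : TFun n}
    (h : ContDiffOn ℝ ∞ (fun p : Coord n × Coord n => H p.1 p.2) D) (A : Fin (n + 1)) :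
    ContDiffOn ℝ ∞ (fun p : Coord n × Coord n => dY H A p.1 p.2) D :=
  (contDiffOn_fderiv_apply hD h _).congr (dY_eq_fderiv hD h A)

lemma fderiv_fderiv_apply_comm (hD : IsOpen D) {F : Coord n × Coord n → ℝ}
    (h : ContDiffOn ℝ ∞ F D) {p : Coord n × Coord n} (hp : p ∈ D) (v w : Coord n × Coord n) :
    fderiv ℝ (fun q => fderiv ℝ F q v) p w = fderiv ℝ (fun q => fderiv ℝ F q w) p v := by
  have hd : DifferentiableAt ℝ (fderiv ℝ F) p :=
    ((h.fderiv_of_isOpen hD (m := ∞) (by simp)).contDiffAt (hD.mem_nhds hp)).differentiableAt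
      (by simp)
  have hs : IsSymmSndFDerivAt ℝ F p :=
    (h.contDiffAt (hD.mem_nhds hp)).isSymmSndFDerivAt
      (by simpa using WithTop.coe_le_coe.2 (le_top : (2 : ℕ∞) ≤ ⊤))
  rw [fderiv_clm_apply hd (differentiableAt_const _),
    fderiv_clm_apply hd (differentiableAt_const _)]
  simpa using hs w v

lemma fderiv_congr_on (hD : IsOpen D) {F K : Coord n × Coord n → ℝ} (h : ∀ p ∈ D, F p = K p)
    {p : Coord n × Coord n} (hp : p ∈ D) : fderiv ℝ F p = fderiv ℝ K p :=
  Filter.EventuallyEq.fderiv_eq (by filter_upwards [hD.mem_nhds hp] with q hq using h q hq)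

lemma dY_dX_comm (hD : IsOpen D) {H : TFun n}
    (h : ContDiffOn ℝ ∞ (fun p : Coord n × Coord n => H p.1 p.2) D) (A B : Fin (n + 1))
    {x y : Coord n} (hp : (x, y) ∈ D) : dY (dX H A) B x y = dX (dY H B) A x y := by
  rw [dY_eq_fderiv hD (smooth_dX hD h A) B _ hp, dX_eq_fderiv hD (smooth_dY hD h B) A _ hp,
    fderiv_congr_on hD (dX_eq_fderiv hD h A) hp, fderiv_congr_on hD (dY_eq_fderiv hD h B) hp]
  exact fderiv_fderiv_apply_comm hD h hp _ _

lemma dY_dY_comm (hD : IsOpen D) {H : TFun n}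
    (h : ContDiffOn ℝ ∞ (fun p : Coord n × Coord n => H p.1 p.2) D) (A B : Fin (n + 1))
    {x y : Coord n} (hp : (x, y) ∈ D) : dY (dY H A) B x y = dY (dY H B) A x y := by
  rw [dY_eq_fderiv hD (smooth_dY hD h A) B _ hp, dY_eq_fderiv hD (smooth_dY hD h B) A _ hp,
    fderiv_congr_on hD (dY_eq_fderiv hD h A) hp, fderiv_congr_on hD (dY_eq_fderiv hD h B) hp]
  exact fderiv_fderiv_apply_comm hD h hp _ _

lemma dX_sum (hD : IsOpen D) {ι : Type*} [Fintype ι] {H : ι → TFun n}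
    (h : ∀ i, ContDiffOn ℝ ∞ (fun p : Coord n × Coord n => H i p.1 p.2) D) (A : Fin (n + 1))
    {x y : Coord n} (hp : (x, y) ∈ D) :
    dX (fun x y => ∑ i, H i x y) A x y = ∑ i, dX (H i) A x y := by
  have h' : HasLineDerivAt ℝ (fun x' => ∑ i, H i x' y) (∑ i, dX (H i) A x y) x (std A) := by
    unfold HasLineDerivAt
    refine HasDerivAt.fun_sum fun i _ => ?_
    rw [dX_eq_fderiv hD (h i) A _ hp]
    exact lineDerivAt_dX (differentiableAt_of_smooth hD (h i) hp) A
  exact dX_eq_of h'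

lemma dY_sum (hD : IsOpen D) {ι : Type*} [Fintype ι] {H : ι → TFun n}
    (h : ∀ i, ContDiffOn ℝ ∞ (fun p : Coord n × Coord n => H i p.1 p.2) D) (A : Fin (n + 1))
    {x y : Coord n} (hp : (x, y) ∈ D) :
    dY (fun x y => ∑ i, H i x y) A x y = ∑ i, dY (H i) A x y := by
  have h' : HasLineDerivAt ℝ (fun y' => ∑ i, H i x y') (∑ i, dY (H i) A x y) y (std A) := by
    unfold HasLineDerivAt
    refine HasDerivAt.fun_sum fun i _ => ?_
    rw [dY_eq_fderiv hD (h i) A _ hp]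
    exact lineDerivAt_dY (differentiableAt_of_smooth hD (h i) hp) A
  exact dY_eq_of h'

/-- The Ricci curvature through the divergence `W` of the spray coefficients `G`. -/
lemma ricci_eq_of_spray (hD : IsOpen D) {L : TFun n} {G : Fin (n + 1) → TFun n} {W : TFun n}
    (hG : ∀ C x y, (x, y) ∈ D → spray L C x y = G C x y)
    (hs : ∀ C, ContDiffOn ℝ ∞ (fun p : Coord n × Coord n => G C p.1 p.2) D)
    (hW : ∀ x y, (x, y) ∈ D → ∑ C, dY (G C) C x y = W x y) {x y : Coord n} (hp : (x, y) ∈ D) :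
    ricci L x y = 2 * ∑ C, dX (G C) C x y - ∑ A, dX W A x y * y A
      + 2 * ∑ A, G A x y * dY W A x y - ∑ C, ∑ A, dY (G C) A x y * dY (G A) C x y := by
  have e1 : ∀ C A, dX (spray L C) A x y = dX (G C) A x y := fun C A => dX_congr hD (hG C) A _ _ hp
  have e2 : ∀ C A, dY (spray L C) A x y = dY (G C) A x y := fun C A => dY_congr hD (hG C) A _ _ hp
  -- By symmetry of second derivatives the contracted ∂/∂y^C acts on G^C first, so summing over C
  -- leaves a single derivative of the divergence W; the same happens in `e4`.
  have e3 : ∀ C A, dY (dX (spray L C) A) C x y = dX (dY (G C) C) A x y := fun C A => by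
    rw [dY_congr hD (dX_congr hD (hG C) A) C _ _ hp, dY_dX_comm hD (hs C) A C hp]
  have e4 : ∀ C A, dY (dY (spray L C) A) C x y = dY (dY (G C) C) A x y := fun C A => by
    rw [dY_congr hD (dY_congr hD (hG C) A) C _ _ hp, dY_dY_comm hD (hs C) A C hp]
  have e5 : ∀ A, ∑ C, dX (dY (G C) C) A x y = dX W A x y := fun A => by
    rw [← dX_sum hD (fun C => smooth_dY hD (hs C) C) A hp]
    exact dX_congr hD hW A _ _ hp
  have e6 : ∀ A, ∑ C, dY (dY (G C) C) A x y = dY W A x y := fun A => by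
    rw [← dY_sum hD (fun C => smooth_dY hD (hs C) C) A hp]
    exact dY_congr hD hW A _ _ hp
  simp only [ricci, flagCurvature, e1, e2, e3, e4, hG _ _ _ hp, Finset.sum_sub_distrib,
    Finset.sum_add_distrib, ← Finset.mul_sum]
  congr 3
  · rw [Finset.sum_comm]
    exact Finset.sum_congr rfl fun A _ => by rw [← Finset.sum_mul, e5]
  · rw [Finset.sum_comm]
    congr 1
    exact funext fun A => by rw [← Finset.mul_sum, e6]

/-! ### Signed powers -/

/-- The odd extension of `s ↦ s ^ p`. -/
def signedPow (p s : ℝ) : ℝ := Real.sign s * |s| ^ p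

lemma signedPow_of_nonneg {p s : ℝ} (hp : p ≠ 0) (hs : 0 ≤ s) : signedPow p s = s ^ p := by
  rcases hs.eq_or_lt with rfl | hs
  · simp [signedPow, Real.zero_rpow hp]
  · simp [signedPow, Real.sign_of_pos hs, abs_of_pos hs]

lemma signedPow_mul_of_pos {p c s : ℝ} (hc : 0 < c) :
    signedPow p (c * s) = c ^ p * signedPow p s := by
  have h : Real.sign (c * s) = Real.sign s := by
    rcases lt_trichotomy s 0 with h | rfl | h
    · rw [Real.sign_of_neg h, Real.sign_of_neg (mul_neg_of_pos_of_neg hc h)]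
    · simp
    · rw [Real.sign_of_pos h, Real.sign_of_pos (mul_pos hc h)]
  rw [signedPow, signedPow, h, abs_mul, abs_of_pos hc, Real.mul_rpow hc.le (abs_nonneg s)]
  ring

lemma signedPow_ne_zero_iff {p s : ℝ} (hp : p ≠ 0) : signedPow p s ≠ 0 ↔ s ≠ 0 := by
  rw [signedPow, Ne, Ne, mul_eq_zero, Real.sign_eq_zero_iff, Real.rpow_eq_zero (abs_nonneg s) hp,
    abs_eq_zero, or_self]

lemma hasDerivAt_abs_rpow (q : ℝ) {s : ℝ} (hs : s ≠ 0) :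
    HasDerivAt (fun s => |s| ^ q) (q * |s| ^ q / s) s := by
  have h := (Real.hasDerivAt_rpow_const (p := q) (Or.inl (abs_ne_zero.2 hs))).comp s
    (hasDerivAt_abs hs)
  refine h.congr_deriv ?_
  rw [Real.rpow_sub_one (abs_ne_zero.2 hs)]
  rcases lt_or_gt_of_ne hs with h | h
  · simp [abs_of_neg h, h, div_neg, mul_div_assoc]
  · simp [abs_of_pos h, h, mul_div_assoc]

/-- The derivative of an odd function is even: one formula covers both signs of s. This is what
keeps the conformal factor positive where S < 0. -/
lemma hasDerivAt_signedPow (p : ℝ) {s : ℝ} (hs : s ≠ 0) :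
    HasDerivAt (signedPow p) (p * |s| ^ (p - 1)) s := by
  rw [Real.rpow_sub_one (abs_ne_zero.2 hs)]
  rcases lt_or_gt_of_ne hs with h | h
  · have h1 : signedPow p =ᶠ[𝓝 s] fun s => -|s| ^ p := by
      filter_upwards [gt_mem_nhds h] with r hr
      simp [signedPow, Real.sign_of_neg hr]
    refine ((hasDerivAt_abs_rpow p hs).neg.congr_of_eventuallyEq h1).congr_deriv ?_
    rw [abs_of_neg h]
    field_simp
  · have h1 : signedPow p =ᶠ[𝓝 s] fun s => |s| ^ p := by
      filter_upwards [lt_mem_nhds h] with r hr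
      simp [signedPow, Real.sign_of_pos hr]
    refine ((hasDerivAt_abs_rpow p hs).congr_of_eventuallyEq h1).congr_deriv ?_
    rw [abs_of_pos h]
    field_simp

lemma contDiffAt_signedPow {k : ℕ∞ω} (p : ℝ) {s : ℝ} (hs : s ≠ 0) :
    ContDiffAt ℝ k (signedPow p) s := by
  rcases lt_or_gt_of_ne hs with h | h
  · have h1 : signedPow p =ᶠ[𝓝 s] fun s => -(-s) ^ p := by
      filter_upwards [gt_mem_nhds h] with r hr
      simp [signedPow, Real.sign_of_neg hr, abs_of_neg hr]
    exact ((contDiffAt_id.neg.rpow_const_of_ne (neg_ne_zero.2 hs)).neg).congr_of_eventuallyEq h1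
  · have h1 : signedPow p =ᶠ[𝓝 s] fun s => s ^ p := by
      filter_upwards [lt_mem_nhds h] with r hr
      simp [signedPow, Real.sign_of_pos hr, abs_of_pos hr]
    exact (contDiffAt_id.rpow_const_of_ne hs).congr_of_eventuallyEq h1

/-! ### The polynomial `S = a(ρ) (y⁰)^(2j+4) + b(ρ) |ȳ|^(2j+4)` -/

variable {I : Set ℝ} {j : ℕ} {a b : ℝ → ℝ} {L : TFun n}

/-- The `m`-th power form `S = a(ρ) (y⁰)^m + b(ρ) |ȳ|^m`, `m = 2j + 4`. -/
def rootS (j : ℕ) (a b : ℝ → ℝ) : TFun n := fun x y =>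
  a (spatialNorm x) * y 0 ^ (2 * j + 4) + b (spatialNorm x) * sdot y y ^ (j + 2)

/-- The derivative of `rootS` in the direction `v` of the fibre. -/
def rootSY (j : ℕ) (a b : ℝ → ℝ) (x y v : Coord n) : ℝ :=
  (2 * j + 4) * (a (spatialNorm x) * y 0 ^ (2 * j + 3) * v 0
    + b (spatialNorm x) * sdot y y ^ (j + 1) * sdot y v)

/-- The second derivative of `rootS` in the directions `v`, `w` of the fibre. -/
def rootSYY (j : ℕ) (a b : ℝ → ℝ) (x y v w : Coord n) : ℝ :=
  (2 * j + 4) * ((2 * j + 3) * a (spatialNorm x) * y 0 ^ (2 * j + 2) * (v 0 * w 0)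
    + b (spatialNorm x) * sdot y y ^ j
      * (sdot y y * sdot v w + (2 * j + 2) * (sdot y v * sdot y w)))

/-- The derivative of `rootS` in the direction `v` of the base. -/
def rootSX (j : ℕ) (a b : ℝ → ℝ) (x y v : Coord n) : ℝ :=
  rootS j (deriv a) (deriv b) x y * (sdot x v / spatialNorm x)

/-- The mixed second derivative of `rootS`. -/
def rootSYX (j : ℕ) (a b : ℝ → ℝ) (x y v w : Coord n) : ℝ :=
  rootSY j (deriv a) (deriv b) x y v * (sdot x w / spatialNorm x)

/-- The part of the tangent bundle where `S` is defined and non-degenerate. -/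
def rootDomain (n : ℕ) (I : Set ℝ) (j : ℕ) (a b : ℝ → ℝ) : Set (Coord n × Coord n) :=
  {p | spatialNorm p.1 ∈ I ∧ p.2 0 ≠ 0 ∧ sdot p.2 p.2 ≠ 0 ∧ rootS j a b p.1 p.2 ≠ 0}

/-- `L = S^{2/m}` on the domain where it is regular, with smooth coefficients `a > 0`, `b ≠ 0`. -/
structure IsRootMetric (I : Set ℝ) (j : ℕ) (a b : ℝ → ℝ) (L : TFun n) : Prop where
  isOpen : IsOpen I
  subset_Ioi : I ⊆ Ioi 0
  smooth_a : ContDiffOn ℝ ∞ a I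
  smooth_b : ContDiffOn ℝ ∞ b I
  a_pos : ∀ ρ ∈ I, 0 < a ρ
  b_ne : ∀ ρ ∈ I, b ρ ≠ 0
  eq_pow : ∀ x y, (x, y) ∈ rootDomain n I j a b →
    L x y = signedPow ((j : ℝ) + 2)⁻¹ (rootS j a b x y)

lemma lineDerivAt_radial {f : ℝ → ℝ} {f' : ℝ} {x : Coord n} (hx : spatialNorm x ≠ 0)
    (hf : HasDerivAt f f' (spatialNorm x)) (v : Coord n) :
    HasLineDerivAt ℝ (fun x : Coord n => f (spatialNorm x)) (f' * (sdot x v / spatialNorm x)) x v :=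
  lineDerivAt_comp (f := fun x : Coord n => spatialNorm x) hf (lineDerivAt_spatialNorm hx v)

lemma lineDerivAt_rootS_right (x y v : Coord n) :
    HasLineDerivAt ℝ (fun y => rootS j a b x y) (rootSY j a b x y v) y v := by
  have h := lineDerivAt_add
    (lineDerivAt_const_mul (a (spatialNorm x))
      (lineDerivAt_pow (2 * j + 4) (lineDerivAt_apply y v 0)))
    (lineDerivAt_const_mul (b (spatialNorm x))
      (lineDerivAt_pow (j + 2) (lineDerivAt_sdot_self y v)))
  refine lineDerivAt_congr h ?_
  simp only [rootSY, Nat.add_succ_sub_one, Nat.cast_add, Nat.cast_mul, Nat.cast_ofNat]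
  ring

lemma lineDerivAt_rootSY_right (x y v w : Coord n) :
    HasLineDerivAt ℝ (fun y => rootSY j a b x y v) (rootSYY j a b x y v w) y w := by
  have h := lineDerivAt_const_mul (2 * (j : ℝ) + 4) (lineDerivAt_add
    (lineDerivAt_mul_const (v 0) (lineDerivAt_const_mul (a (spatialNorm x))
      (lineDerivAt_pow (2 * j + 3) (lineDerivAt_apply y w 0))))
    (lineDerivAt_mul (lineDerivAt_const_mul (b (spatialNorm x))
      (lineDerivAt_pow (j + 1) (lineDerivAt_sdot_self y w))) (lineDerivAt_sdot_left y w v)))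
  refine lineDerivAt_congr h ?_
  simp only [rootSYY, Nat.add_succ_sub_one, Nat.cast_add, Nat.cast_mul, Nat.cast_ofNat,
    Nat.cast_one, sdot_comm w v]
  ring

section Base
variable {x : Coord n} (hx : spatialNorm x ≠ 0) (ha : DifferentiableAt ℝ a (spatialNorm x))
  (hb : DifferentiableAt ℝ b (spatialNorm x))
include hx ha hb

lemma lineDerivAt_rootS_left (y v : Coord n) :
    HasLineDerivAt ℝ (fun x => rootS j a b x y) (rootSX j a b x y v) x v := by
  have h := lineDerivAt_add
    (lineDerivAt_mul_const (y 0 ^ (2 * j + 4)) (lineDerivAt_radial hx ha.hasDerivAt v))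
    (lineDerivAt_mul_const (sdot y y ^ (j + 2)) (lineDerivAt_radial hx hb.hasDerivAt v))
  refine lineDerivAt_congr h ?_
  simp only [rootSX, rootS]
  ring

lemma lineDerivAt_rootSY_left (y v w : Coord n) :
    HasLineDerivAt ℝ (fun x => rootSY j a b x y v) (rootSYX j a b x y v w) x w := by
  have h := lineDerivAt_const_mul (2 * (j : ℝ) + 4) (lineDerivAt_add
    (lineDerivAt_mul_const (v 0) (lineDerivAt_mul_const (y 0 ^ (2 * j + 3))
      (lineDerivAt_radial hx ha.hasDerivAt w)))
    (lineDerivAt_mul_const (sdot y v) (lineDerivAt_mul_const (sdot y y ^ (j + 1))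
      (lineDerivAt_radial hx hb.hasDerivAt w))))
  refine lineDerivAt_congr h ?_
  simp only [rootSYX, rootSY]
  ring

end Base

lemma contDiffAt_radial {f : ℝ → ℝ} (hI : IsOpen I) (hpos : I ⊆ Ioi 0) (hf : ContDiffOn ℝ ∞ f I)
    {p : Coord n × Coord n} (hp : spatialNorm p.1 ∈ I) :
    ContDiffAt ℝ ∞ (fun p : Coord n × Coord n => f (spatialNorm p.1)) p :=
  ContDiffAt.comp p (hf.contDiffAt (hI.mem_nhds hp))
    (ContDiffAt.comp (f := Prod.fst) (g := spatialNorm) p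
      (contDiffAt_spatialNorm (hpos hp).ne') contDiffAt_fst)

lemma isOpen_rootDomain (hI : IsOpen I) (ha : ContinuousOn a I) (hb : ContinuousOn b I) :
    IsOpen (rootDomain n I j a b) := by
  have h1 : IsOpen {p : Coord n × Coord n | spatialNorm p.1 ∈ I} :=
    hI.preimage (continuous_spatialNorm.comp continuous_fst)
  have h2 : Continuous fun p : Coord n × Coord n => p.2 0 := by fun_prop
  have h3 : Continuous fun p : Coord n × Coord n => sdot p.2 p.2 :=
    (contDiff_sdot (k := 0) contDiff_snd contDiff_snd).continuous
  have h4 : ContinuousOn (fun p : Coord n × Coord n => rootS j a b p.1 p.2)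
      {p | spatialNorm p.1 ∈ I} := by
    have hn : ContinuousOn (fun p : Coord n × Coord n => spatialNorm p.1)
      {p | spatialNorm p.1 ∈ I} := (continuous_spatialNorm.comp continuous_fst).continuousOn
    exact ((ha.comp hn fun p hp => hp).mul (h2.pow _).continuousOn).add
      ((hb.comp hn fun p hp => hp).mul (h3.pow _).continuousOn)
  have h5 := ((isOpen_ne_fun h2 (continuous_const (y := (0 : ℝ)))).inter
    (isOpen_ne_fun h3 (continuous_const (y := (0 : ℝ))))).inter
    (h4.isOpen_inter_preimage h1 (isOpen_compl_singleton (x := (0 : ℝ))))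
  convert h5 using 1
  ext p
  simp only [rootDomain, mem_ofPred_eq, mem_inter_iff, mem_preimage, mem_compl_iff,
    mem_singleton_iff]
  tauto

/-! ### Smoothness and partial derivatives of L through those of S -/

namespace IsRootMetric
variable (h : IsRootMetric I j a b L)
include h

lemma isOpen_domain : IsOpen (rootDomain n I j a b) :=
  isOpen_rootDomain h.isOpen h.smooth_a.continuousOn h.smooth_b.continuousOn

lemma smooth_rootS :
    ContDiffOn ℝ ∞ (fun p : Coord n × Coord n => rootS j a b p.1 p.2) (rootDomain n I j a b) := by
  intro p hp
  have h1 := contDiffAt_radial h.isOpen h.subset_Ioi h.smooth_a hp.1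
  have h2 := contDiffAt_radial h.isOpen h.subset_Ioi h.smooth_b hp.1
  have h3 : ContDiff ℝ ∞ fun p : Coord n × Coord n => sdot p.2 p.2 :=
    contDiff_sdot contDiff_snd contDiff_snd
  have h4 : ContDiff ℝ ∞ fun p : Coord n × Coord n => p.2 0 := by fun_prop
  exact ((h1.mul (h4.pow _).contDiffAt).add (h2.mul (h3.pow _).contDiffAt)).contDiffWithinAt

lemma smooth :
    ContDiffOn ℝ ∞ (fun p : Coord n × Coord n => L p.1 p.2) (rootDomain n I j a b) := by
  refine ContDiffOn.congr (fun p hp => ?_) fun p hp => h.eq_pow p.1 p.2 hp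
  exact (contDiffAt_signedPow _ hp.2.2.2).comp_contDiffWithinAt p (h.smooth_rootS p hp)

variable {x y : Coord n} (hp : (x, y) ∈ rootDomain n I j a b)
include hp

lemma spatialNorm_ne : spatialNorm x ≠ 0 := (h.subset_Ioi hp.1).ne'

lemma differentiableAt_a : DifferentiableAt ℝ a (spatialNorm x) :=
  (h.smooth_a.contDiffAt (h.isOpen.mem_nhds hp.1)).differentiableAt (by simp)

lemma differentiableAt_b : DifferentiableAt ℝ b (spatialNorm x) :=
  (h.smooth_b.contDiffAt (h.isOpen.mem_nhds hp.1)).differentiableAt (by simp)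

omit hp in
lemma dX_eq (A : Fin (n + 1)) : ∀ x y, (x, y) ∈ rootDomain n I j a b → dX L A x y =
    ((j : ℝ) + 2)⁻¹ * |rootS j a b x y| ^ (((j : ℝ) + 2)⁻¹ - 1) * rootSX j a b x y (std A) := by
  intro x y hp
  rw [dX_congr h.isOpen_domain h.eq_pow A _ _ hp]
  exact dX_eq_of (lineDerivAt_comp (f := fun x => rootS j a b x y)
    (hasDerivAt_signedPow _ hp.2.2.2) (lineDerivAt_rootS_left (h.spatialNorm_ne hp)
      (h.differentiableAt_a hp) (h.differentiableAt_b hp) y (std A)))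

omit hp in
lemma dY_eq (A : Fin (n + 1)) : ∀ x y, (x, y) ∈ rootDomain n I j a b → dY L A x y =
    ((j : ℝ) + 2)⁻¹ * |rootS j a b x y| ^ (((j : ℝ) + 2)⁻¹ - 1) * rootSY j a b x y (std A) := by
  intro x y hp
  rw [dY_congr h.isOpen_domain h.eq_pow A _ _ hp]
  exact dY_eq_of (lineDerivAt_comp (f := fun y => rootS j a b x y)
    (hasDerivAt_signedPow _ hp.2.2.2) (lineDerivAt_rootS_right x y (std A)))

lemma dY_dY_eq (A B : Fin (n + 1)) : dY (dY L A) B x y =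
    ((j : ℝ) + 2)⁻¹ * |rootS j a b x y| ^ (((j : ℝ) + 2)⁻¹ - 1) *
      (rootSYY j a b x y (std A) (std B) - (2 * j + 2) / (2 * j + 4) *
        rootSY j a b x y (std A) * rootSY j a b x y (std B) / rootS j a b x y) := by
  rw [dY_congr h.isOpen_domain (h.dY_eq A) B _ _ hp]
  have h1 := lineDerivAt_comp (f := fun y => rootS j a b x y)
    (hasDerivAt_abs_rpow (((j : ℝ) + 2)⁻¹ - 1) hp.2.2.2) (lineDerivAt_rootS_right x y (std B))
  have h2 := lineDerivAt_mul (lineDerivAt_const_mul ((j : ℝ) + 2)⁻¹ h1)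
    (lineDerivAt_rootSY_right (j := j) (a := a) (b := b) x y (std A) (std B))
  rw [dY_eq_of h2]
  have := hp.2.2.2
  have hj : (j : ℝ) + 2 ≠ 0 := by positivity
  have hj' : (2 * j : ℝ) + 4 ≠ 0 := by positivity
  have e : ((j : ℝ) + 2)⁻¹ - 1 = - ((2 * j + 2) / (2 * j + 4)) := by field_simp; ring
  -- The power is hidden first, so that `e` rewrites only the numerical factor 2/m − 1 = −(m−2)/m
  -- produced by differentiating it.
  generalize |rootS j a b x y| ^ (((j : ℝ) + 2)⁻¹ - 1) = θ
  rw [e]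
  ring

lemma dX_dY_eq (A B : Fin (n + 1)) : dX (dY L A) B x y =
    ((j : ℝ) + 2)⁻¹ * |rootS j a b x y| ^ (((j : ℝ) + 2)⁻¹ - 1) *
      (rootSYX j a b x y (std A) (std B) - (2 * j + 2) / (2 * j + 4) *
        rootSY j a b x y (std A) * rootSX j a b x y (std B) / rootS j a b x y) := by
  rw [dX_congr h.isOpen_domain (h.dY_eq A) B _ _ hp]
  have h1 := lineDerivAt_comp (f := fun x => rootS j a b x y)
    (hasDerivAt_abs_rpow (((j : ℝ) + 2)⁻¹ - 1) hp.2.2.2) (lineDerivAt_rootS_left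
      (h.spatialNorm_ne hp) (h.differentiableAt_a hp) (h.differentiableAt_b hp) y (std B))
  have h2 := lineDerivAt_mul (lineDerivAt_const_mul ((j : ℝ) + 2)⁻¹ h1)
    (lineDerivAt_rootSY_left (j := j) (h.spatialNorm_ne hp) (h.differentiableAt_a hp)
      (h.differentiableAt_b hp) y (std A) (std B))
  rw [dX_eq_of h2]
  have hj : (j : ℝ) + 2 ≠ 0 := by positivity
  have hj' : (2 * j : ℝ) + 4 ≠ 0 := by positivity
  have e : ((j : ℝ) + 2)⁻¹ - 1 = - ((2 * j + 2) / (2 * j + 4)) := by field_simp; ring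
  generalize |rootS j a b x y| ^ (((j : ℝ) + 2)⁻¹ - 1) = θ
  rw [e]
  ring

end IsRootMetric

/-! ### The fundamental tensor -/

/-- The conformal factor `(2/m) |S|^{2/m - 1}`. -/
def rootTheta (j : ℕ) (a b : ℝ → ℝ) (x y : Coord n) : ℝ :=
  ((j : ℝ) + 2)⁻¹ * |rootS j a b x y| ^ (((j : ℝ) + 2)⁻¹ - 1)

/-- The fundamental tensor of `S^{2/m}` as a bilinear form. -/
def rootForm (j : ℕ) (a b : ℝ → ℝ) (x y v w : Coord n) : ℝ :=
  1 / 2 * rootTheta j a b x y * (rootSYY j a b x y v w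
    - (2 * j + 2) / (2 * j + 4) * rootSY j a b x y v * rootSY j a b x y w / rootS j a b x y)

lemma rootTheta_pos {x y : Coord n} (hS : rootS j a b x y ≠ 0) : 0 < rootTheta j a b x y := by
  have := Real.rpow_pos_of_pos (abs_pos.2 hS) (((j : ℝ) + 2)⁻¹ - 1)
  unfold rootTheta
  positivity

/-- Linearity in the last slot. Together with its analogues for the other forms, this turns index
contractions into evaluations at a vector, so no coordinates are needed later. -/
lemma sum_rootSY_std_mul (x y w : Coord n) :
    ∑ B, rootSY j a b x y (std B) * w B = rootSY j a b x y w := by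
  have h : ∀ B, rootSY j a b x y (std B) * w B =
      (2 * j + 4) * a (spatialNorm x) * y 0 ^ (2 * j + 3) * (std B 0 * w B) +
      (2 * j + 4) * b (spatialNorm x) * sdot y y ^ (j + 1) * (sdot y (std B) * w B) := fun B => by
    unfold rootSY; ring
  simp only [h, Finset.sum_add_distrib, ← Finset.mul_sum, sum_std_zero_mul, sum_sdot_std_mul]
  unfold rootSY; ring

lemma sum_rootSYY_std_mul (x y v w : Coord n) :
    ∑ B, rootSYY j a b x y v (std B) * w B = rootSYY j a b x y v w := by
  have h : ∀ B, rootSYY j a b x y v (std B) * w B =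
      (2 * j + 4) * (2 * j + 3) * a (spatialNorm x) * y 0 ^ (2 * j + 2) * v 0 * (std B 0 * w B) +
      (2 * j + 4) * b (spatialNorm x) * sdot y y ^ j * sdot y y * (sdot v (std B) * w B) +
      (2 * j + 4) * b (spatialNorm x) * sdot y y ^ j * (2 * j + 2) * sdot y v *
        (sdot y (std B) * w B) := fun B => by
    unfold rootSYY; ring
  simp only [h, Finset.sum_add_distrib, ← Finset.mul_sum, sum_std_zero_mul, sum_sdot_std_mul]
  unfold rootSYY; ring

lemma rootSYY_comm (x y v w : Coord n) : rootSYY j a b x y v w = rootSYY j a b x y w v := by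
  unfold rootSYY; rw [sdot_comm v w]; ring

lemma rootForm_comm (x y v w : Coord n) : rootForm j a b x y v w = rootForm j a b x y w v := by
  unfold rootForm; rw [rootSYY_comm]; ring

lemma sum_rootForm_std_mul (x y v w : Coord n) :
    ∑ B, rootForm j a b x y v (std B) * w B = rootForm j a b x y v w := by
  have h : ∀ B, rootForm j a b x y v (std B) * w B =
      1 / 2 * rootTheta j a b x y * (rootSYY j a b x y v (std B) * w B) -
      1 / 2 * rootTheta j a b x y * ((2 * j + 2) / (2 * j + 4)) * rootSY j a b x y v
        / rootS j a b x y * (rootSY j a b x y (std B) * w B) := fun B => by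
    unfold rootForm; ring
  simp only [h, Finset.sum_sub_distrib, ← Finset.mul_sum, sum_rootSY_std_mul, sum_rootSYY_std_mul]
  unfold rootForm; ring

lemma rootSY_self (x y : Coord n) : rootSY j a b x y y = (2 * j + 4) * rootS j a b x y := by
  unfold rootSY rootS; ring

/-- Euler's relation: S_Y is homogeneous of degree m − 1 = 2j + 3 in y. -/
lemma rootSYY_self (x y v : Coord n) :
    rootSYY j a b x y v y = (2 * j + 3) * rootSY j a b x y v := by
  unfold rootSYY rootSY; rw [sdot_comm v y]; ring

/-- By Euler's relations the bracket is (m−1) S_Y(v) − (m−2) S_Y(v), which is S_Y(v). -/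
lemma rootForm_self {x y : Coord n} (hS : rootS j a b x y ≠ 0) (v : Coord n) :
    rootForm j a b x y v y = 1 / 2 * rootTheta j a b x y * rootSY j a b x y v := by
  unfold rootForm
  rw [rootSYY_self, rootSY_self]
  have hj : (2 * j : ℝ) + 4 ≠ 0 := by positivity
  field_simp
  ring

namespace IsRootMetric
variable (h : IsRootMetric I j a b L)
  {x y : Coord n} (hp : (x, y) ∈ rootDomain n I j a b)
include h hp

lemma fundTensor_apply (A B : Fin (n + 1)) :
    fundTensor L x y A B = rootForm j a b x y (std A) (std B) := by
  rw [fundTensor, Matrix.of_apply, h.dY_dY_eq hp, rootForm, rootTheta]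
  ring

lemma fundTensor_mulVec (w : Coord n) (A : Fin (n + 1)) :
    (fundTensor L x y).mulVec w A = rootForm j a b x y (std A) w := by
  simp only [Matrix.mulVec, dotProduct, h.fundTensor_apply hp]
  exact sum_rootForm_std_mul x y _ w

lemma dotProduct_fundTensor_mulVec (v w : Coord n) :
    v ⬝ᵥ (fundTensor L x y).mulVec w = rootForm j a b x y v w := by
  simp only [dotProduct, h.fundTensor_mulVec hp]
  rw [rootForm_comm, ← sum_rootForm_std_mul]
  exact Finset.sum_congr rfl fun A _ => by rw [rootForm_comm, mul_comm]

lemma isSymm_fundTensor : (fundTensor L x y).IsSymm := by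
  ext A B
  rw [Matrix.transpose_apply, h.fundTensor_apply hp, h.fundTensor_apply hp, rootForm_comm]

omit h in
lemma sdot_self_pos : 0 < sdot y y := (sdot_self_nonneg y).lt_of_ne' hp.2.2.1

/-- Pairing a null vector v with y gives S_Y(v) = 0, which removes the rank-one term and leaves
S_YY(·, v) = 0. Its 0-component kills v⁰; then S_Y(v) = 0 gives ⟨y, v⟩ = 0, and the spatial
components of S_YY kill the rest. The argument does not depend on the sign of b. -/
lemma eq_zero_of_mulVec_eq_zero {v : Coord n} (hv : (fundTensor L x y).mulVec v = 0) : v = 0 := by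
  have hθ := rootTheta_pos hp.2.2.2
  have hN := sdot_self_pos hp
  have ha := h.a_pos _ hp.1
  have hb := h.b_ne _ hp.1
  have hu := hp.2.1
  have h1 : rootSY j a b x y v = 0 := by
    have := h.dotProduct_fundTensor_mulVec hp y v
    rw [hv, dotProduct_zero, rootForm_comm, rootForm_self hp.2.2.2] at this
    simpa [hθ.ne'] using this.symm
  have h2 : ∀ A, rootSYY j a b x y (std A) v = 0 := fun A => by
    have := h.fundTensor_mulVec hp v A
    rw [hv, rootForm, h1] at this
    simpa [hθ.ne'] using this.symm
  have hj : (2 * j : ℝ) + 4 ≠ 0 := by positivity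
  have hj' : (2 * j : ℝ) + 3 ≠ 0 := by positivity
  have h0 : v 0 = 0 := by simpa [rootSYY, hj, hj', ha.ne', hu] using h2 0
  have h3 : sdot y v = 0 := by simpa [rootSY, h0, hj, hb, hN.ne'] using h1
  funext A
  refine Fin.cases h0 (fun i => ?_) A
  simpa [rootSYY, h0, h3, hj, hb, hN.ne'] using h2 i.succ

lemma isUnit_det_fundTensor : IsUnit (fundTensor L x y).det := by
  rw [isUnit_iff_ne_zero]
  intro h0
  obtain ⟨v, hv, hv'⟩ := Matrix.exists_mulVec_eq_zero_iff.2 h0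
  exact hv (h.eq_zero_of_mulVec_eq_zero hp hv')

end IsRootMetric

/-! ### The spray -/

/-- The quotient `z^m = (y⁰)^m / |ȳ|^m`. -/
def rootZ (j : ℕ) (y : Coord n) : ℝ := y 0 ^ (2 * j + 4) / sdot y y ^ (j + 2)

/-- The component along `c` of a spray of the form
`G⁰ = lam t y⁰`, `Gⁱ = (mu + p₁ kap z^m) t yⁱ - (mu / 2 + p₂ kap z^m) |ȳ|² xⁱ`, `t = ⟨x̄, ȳ⟩`. -/
def sprayForm (j : ℕ) (lam mu kap : ℝ → ℝ) (x y c : Coord n) : ℝ :=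
  c 0 * (lam (spatialNorm x) * sdot x y * y 0)
    + (mu (spatialNorm x) + (2 * j + 2) / ((2 * j + 4) * (2 * j + 3)) * kap (spatialNorm x)
      * rootZ j y) * sdot x y * sdot y c
    - (mu (spatialNorm x) / 2 + 1 / (2 * j + 4) * kap (spatialNorm x) * rootZ j y) * sdot y y
      * sdot x c

/-- The coefficient of `⟨x̄, ȳ⟩ y⁰` in `G⁰`. -/
def rootLam (j : ℕ) (a : ℝ → ℝ) (ρ : ℝ) : ℝ := deriv a ρ / (2 * (2 * j + 3) * a ρ * ρ)

/-- The coefficient of `⟨x̄, ȳ⟩ yⁱ` in `Gⁱ`. -/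
def rootMu (j : ℕ) (b : ℝ → ℝ) (ρ : ℝ) : ℝ := deriv b ρ / ((2 * j + 4) * b ρ * ρ)

/-- The coefficient of `z^m` in `Gⁱ`. -/
def rootKap (a b : ℝ → ℝ) (ρ : ℝ) : ℝ := deriv a ρ / (2 * b ρ * ρ)

lemma sprayForm_std_zero (lam mu kap : ℝ → ℝ) (x y : Coord n) :
    sprayForm j lam mu kap x y (std 0) = lam (spatialNorm x) * sdot x y * y 0 := by
  simp [sprayForm]

lemma sdot_sprayForm (lam mu kap : ℝ → ℝ) (x y v : Coord n) :
    sdot v (fun C => sprayForm j lam mu kap x y (std C)) =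
      (mu (spatialNorm x) + (2 * j + 2) / ((2 * j + 4) * (2 * j + 3)) * kap (spatialNorm x)
        * rootZ j y) * sdot x y * sdot y v
      - (mu (spatialNorm x) / 2 + 1 / (2 * j + 4) * kap (spatialNorm x) * rootZ j y) * sdot y y
        * sdot x v := by
  have h : ∀ i : Fin n, v i.succ * sprayForm j lam mu kap x y (std i.succ) =
      (mu (spatialNorm x) + (2 * j + 2) / ((2 * j + 4) * (2 * j + 3)) * kap (spatialNorm x)
        * rootZ j y) * sdot x y * (y i.succ * v i.succ)
      - (mu (spatialNorm x) / 2 + 1 / (2 * j + 4) * kap (spatialNorm x) * rootZ j y) * sdot y y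
        * (x i.succ * v i.succ) := fun i => by
    rw [sprayForm, sdot_std_succ, sdot_std_succ, std_succ_apply_zero]
    ring
  rw [sdot, Finset.sum_congr rfl fun i _ => h i, Finset.sum_sub_distrib, ← Finset.mul_sum,
    ← Finset.mul_sum]
  rfl

namespace IsRootMetric
variable (h : IsRootMetric I j a b L)
  {x y : Coord n} (hp : (x, y) ∈ rootDomain n I j a b)
include h hp

/-- Contraction of the Euler–Lagrange equations of S with y. It says that the proposed w also
handles the S_Y ⊗ S_Y part of the fundamental tensor, so the spray of S serves for L. -/
lemma rootSY_spray {w : Coord n}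
    (hw : w = fun C => sprayForm j (rootLam j a) (rootMu j b) (rootKap a b) x y (std C)) :
    2 * rootSY j a b x y w = rootSX j a b x y y := by
  have hN := (sdot_self_pos hp).ne'
  have ha := (h.a_pos _ hp.1).ne'
  have hb := h.b_ne _ hp.1
  have hρ := h.spatialNorm_ne hp
  have h3 : (2 * j : ℝ) + 3 ≠ 0 := by positivity
  have h4 : (2 * j : ℝ) + 4 ≠ 0 := by positivity
  have w0 : w 0 = rootLam j a (spatialNorm x) * sdot x y * y 0 := by
    rw [hw]; exact sprayForm_std_zero ..
  have wy := sdot_sprayForm (j := j) (rootLam j a) (rootMu j b) (rootKap a b) x y y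
  rw [← hw] at wy
  rw [rootSY, w0, wy, rootSX, rootS, rootZ, rootLam, rootMu, rootKap]
  field_simp
  ring

/-- The Euler–Lagrange equations of S itself. The coefficients `rootLam`, `rootMu`, `rootKap` are
their solution, found by matching the components along the 0-axis, y and x. -/
lemma rootSYY_spray {w : Coord n}
    (hw : w = fun C => sprayForm j (rootLam j a) (rootMu j b) (rootKap a b) x y (std C))
    (v : Coord n) :
    2 * rootSYY j a b x y v w = rootSYX j a b x y v y - rootSX j a b x y v := by
  have hN := (sdot_self_pos hp).ne'
  have ha := (h.a_pos _ hp.1).ne'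
  have hb := h.b_ne _ hp.1
  have hρ := h.spatialNorm_ne hp
  have h3 : (2 * j : ℝ) + 3 ≠ 0 := by positivity
  have h4 : (2 * j : ℝ) + 4 ≠ 0 := by positivity
  have w0 : w 0 = rootLam j a (spatialNorm x) * sdot x y * y 0 := by
    rw [hw]; exact sprayForm_std_zero ..
  have wy := sdot_sprayForm (j := j) (rootLam j a) (rootMu j b) (rootKap a b) x y
  rw [← hw] at wy
  rw [rootSYY, w0, wy, wy, rootSYX, rootSY, rootSX, rootS, rootZ, rootLam, rootMu, rootKap]
  field_simp
  ring

/-- The inverse matrix is never computed: the right-hand side of the spray equation is recognized as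
4 times the fundamental tensor applied to w, and invertibility gives w. -/
lemma spray_eq (C : Fin (n + 1)) : spray L C x y =
    sprayForm j (rootLam j a) (rootMu j b) (rootKap a b) x y (std C) := by
  set w : Coord n :=
    fun C => sprayForm j (rootLam j a) (rootMu j b) (rootKap a b) x y (std C) with hw
  have h1 : ∀ A, (∑ B, dX (dY L A) B x y * y B) - dX L A x y =
      4 * (fundTensor L x y).mulVec w A := fun A => by
    have e : ∀ B, dX (dY L A) B x y * y B = rootTheta j a b x y *
        (rootSY j (deriv a) (deriv b) x y (std A) / spatialNorm x
          - (2 * j + 2) / (2 * j + 4) * rootSY j a b x y (std A) / rootS j a b x y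
            * rootS j (deriv a) (deriv b) x y / spatialNorm x) * (sdot x (std B) * y B) := fun B => by
      rw [h.dX_dY_eq hp, rootTheta, rootSYX, rootSX]; ring
    simp only [e, ← Finset.mul_sum, sum_sdot_std_mul]
    rw [h.dX_eq A _ _ hp, h.fundTensor_mulVec hp, rootForm]
    have e1 := h.rootSY_spray hp hw
    have e2 := h.rootSYY_spray hp hw (std A)
    have e3 : rootSYY j a b x y (std A) w =
      (rootSYX j a b x y (std A) y - rootSX j a b x y (std A)) / 2 := by linarith
    have e4 : rootSY j a b x y w = rootSX j a b x y y / 2 := by linarith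
    rw [e3, e4, rootSX, rootSX, rootSYX, ← rootTheta]
    ring
  have h2 : spray L C x y = ((fundTensor L x y)⁻¹.mulVec ((fundTensor L x y).mulVec w)) C := by
    simp only [spray, h1, Matrix.mulVec, dotProduct, Finset.mul_sum]
    refine Finset.sum_congr rfl fun A _ => Finset.sum_congr rfl fun B _ => by ring
  rw [h2, Matrix.mulVec_mulVec, Matrix.nonsing_inv_mul _ (h.isUnit_det_fundTensor hp),
    Matrix.one_mulVec]

end IsRootMetric

/-! ### The Ricci curvature of a spray given by `sprayForm` -/

/-- This is the trace of the square of αI + β yxᵀ + γ xyᵀ + ε yyᵀ, the shape of the spatial block of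
∂G/∂y. Off the diagonal terms, each summand is sorted into a function of i times a function of l, so
the double sums factor. -/
lemma sum_sum_trace_sq (α β γ ε : ℝ) (x y : Coord n) :
    ∑ i : Fin n, ∑ l : Fin n,
      (α * (if i = l then 1 else 0) + β * (y i.succ * x l.succ) + γ * (x i.succ * y l.succ)
        + ε * (y i.succ * y l.succ)) *
      (α * (if l = i then 1 else 0) + β * (y l.succ * x i.succ) + γ * (x l.succ * y i.succ)
        + ε * (y l.succ * y i.succ)) =
    n * α ^ 2 + 2 * α * ((β + γ) * sdot x y + ε * sdot y y) + (β ^ 2 + γ ^ 2) * sdot x y ^ 2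
      + ε ^ 2 * sdot y y ^ 2 + 2 * β * γ * sdot x x * sdot y y
      + 2 * (β + γ) * ε * sdot x y * sdot y y := by
  have h : ∀ i l : Fin n,
      (α * (if i = l then 1 else 0) + β * (y i.succ * x l.succ) + γ * (x i.succ * y l.succ)
        + ε * (y i.succ * y l.succ)) *
      (α * (if l = i then 1 else 0) + β * (y l.succ * x i.succ) + γ * (x l.succ * y i.succ)
        + ε * (y l.succ * y i.succ)) =
      (if i = l then α ^ 2 + 2 * α * (β + γ) * (x i.succ * y i.succ)
        + 2 * α * ε * (y i.succ * y i.succ) else 0)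
      + (β ^ 2 + γ ^ 2) * (x i.succ * y i.succ) * (x l.succ * y l.succ)
      + ε ^ 2 * (y i.succ * y i.succ) * (y l.succ * y l.succ)
      + β * γ * (y i.succ * y i.succ) * (x l.succ * x l.succ)
      + β * γ * (x i.succ * x i.succ) * (y l.succ * y l.succ)
      + (β + γ) * ε * (y i.succ * y i.succ) * (x l.succ * y l.succ)
      + (β + γ) * ε * (x i.succ * y i.succ) * (y l.succ * y l.succ) := fun i l => by
    by_cases hil : i = l
    · subst hil; simp; ring
    · simp [hil, Ne.symm hil]; ring
  simp only [h, Finset.sum_add_distrib, Finset.sum_ite_eq, Finset.mem_univ, if_true,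
    ← Finset.mul_sum, ← Finset.sum_mul]
  simp only [Finset.sum_const, Finset.card_univ, Fintype.card_fin, nsmul_eq_mul, sdot]
  ring

/-- The derivative of `sprayForm` in the direction `v` of the base. -/
def sprayFormX (j : ℕ) (lam mu kap : ℝ → ℝ) (x y c v : Coord n) : ℝ :=
  c 0 * ((deriv lam (spatialNorm x) * (sdot x v / spatialNorm x) * sdot x y
      + lam (spatialNorm x) * sdot v y) * y 0)
    + ((deriv mu (spatialNorm x) + (2 * j + 2) / ((2 * j + 4) * (2 * j + 3))
        * deriv kap (spatialNorm x) * rootZ j y) * (sdot x v / spatialNorm x) * sdot x y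
      + (mu (spatialNorm x) + (2 * j + 2) / ((2 * j + 4) * (2 * j + 3)) * kap (spatialNorm x)
        * rootZ j y) * sdot v y) * sdot y c
    - sdot y y * ((deriv mu (spatialNorm x) / 2 + 1 / (2 * j + 4)
        * deriv kap (spatialNorm x) * rootZ j y) * (sdot x v / spatialNorm x) * sdot x c
      + (mu (spatialNorm x) / 2 + 1 / (2 * j + 4) * kap (spatialNorm x) * rootZ j y) * sdot v c)

/-- The derivative of `rootZ` in the direction `v`. -/
def rootZY (j : ℕ) (y v : Coord n) : ℝ :=
  (2 * j + 4) * rootZ j y * (v 0 / y 0 - sdot y v / sdot y y)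

/-- The derivative of `sprayForm` in the direction `v` of the fibre. -/
def sprayFormY (j : ℕ) (lam mu kap : ℝ → ℝ) (x y c v : Coord n) : ℝ :=
  c 0 * (lam (spatialNorm x) * (sdot x v * y 0 + sdot x y * v 0))
    + ((2 * j + 2) / ((2 * j + 4) * (2 * j + 3)) * kap (spatialNorm x) * rootZY j y v)
      * sdot x y * sdot y c
    + (mu (spatialNorm x) + (2 * j + 2) / ((2 * j + 4) * (2 * j + 3)) * kap (spatialNorm x)
      * rootZ j y) * (sdot x v * sdot y c + sdot x y * sdot v c)
    - (1 / (2 * j + 4) * kap (spatialNorm x) * rootZY j y v) * sdot y y * sdot x c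
    - (mu (spatialNorm x) / 2 + 1 / (2 * j + 4) * kap (spatialNorm x) * rootZ j y)
      * (2 * sdot y v) * sdot x c

/-- The divergence `∑_C ∂G^C / ∂y^C` of `sprayForm`. -/
def sprayDiv (j : ℕ) (lam mu kap : ℝ → ℝ) (x y : Coord n) : ℝ :=
  (lam (spatialNorm x) + n * mu (spatialNorm x)
    + n * ((2 * j + 2) / ((2 * j + 4) * (2 * j + 3))) * kap (spatialNorm x) * rootZ j y)
    * sdot x y

/-- The derivative of `sprayDiv` in the direction `v` of the base. -/
def sprayDivX (j : ℕ) (lam mu kap : ℝ → ℝ) (x y v : Coord n) : ℝ :=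
  (deriv lam (spatialNorm x) + n * deriv mu (spatialNorm x)
    + n * ((2 * j + 2) / ((2 * j + 4) * (2 * j + 3))) * deriv kap (spatialNorm x) * rootZ j y)
    * (sdot x v / spatialNorm x) * sdot x y
  + (lam (spatialNorm x) + n * mu (spatialNorm x)
    + n * ((2 * j + 2) / ((2 * j + 4) * (2 * j + 3))) * kap (spatialNorm x) * rootZ j y)
    * sdot v y

/-- The derivative of `sprayDiv` in the direction `v` of the fibre. -/
def sprayDivY (j : ℕ) (lam mu kap : ℝ → ℝ) (x y v : Coord n) : ℝ :=
  n * ((2 * j + 2) / ((2 * j + 4) * (2 * j + 3))) * kap (spatialNorm x) * rootZY j y v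
    * sdot x y
  + (lam (spatialNorm x) + n * mu (spatialNorm x)
    + n * ((2 * j + 2) / ((2 * j + 4) * (2 * j + 3))) * kap (spatialNorm x) * rootZ j y)
    * sdot x v

section Derivatives
variable {lam mu kap : ℝ → ℝ} {x y : Coord n}

lemma lineDerivAt_rootZ (hu : y 0 ≠ 0) (hN : sdot y y ≠ 0) (v : Coord n) :
    HasLineDerivAt ℝ (fun y : Coord n => rootZ j y) (rootZY j y v) y v := by
  have h := lineDerivAt_div (lineDerivAt_pow (2 * j + 4) (lineDerivAt_apply y v 0))
    (lineDerivAt_pow (j + 2) (lineDerivAt_sdot_self y v)) (pow_ne_zero _ hN)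
  refine lineDerivAt_congr h ?_
  simp only [rootZY, rootZ, Nat.add_succ_sub_one, Nat.cast_add, Nat.cast_mul, Nat.cast_ofNat]
  field_simp
  ring

lemma lineDerivAt_sprayForm_left (hx : spatialNorm x ≠ 0)
    (hl : DifferentiableAt ℝ lam (spatialNorm x)) (hm : DifferentiableAt ℝ mu (spatialNorm x))
    (hk : DifferentiableAt ℝ kap (spatialNorm x)) (c v : Coord n) :
    HasLineDerivAt ℝ (fun x => sprayForm j lam mu kap x y c)
      (sprayFormX j lam mu kap x y c v) x v := by
  have dl := lineDerivAt_radial hx hl.hasDerivAt v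
  have dm := lineDerivAt_radial hx hm.hasDerivAt v
  have dk := lineDerivAt_radial hx hk.hasDerivAt v
  have dt := lineDerivAt_sdot_left x v y
  have dc := lineDerivAt_sdot_left x v c
  have h := lineDerivAt_sub (lineDerivAt_add
    (lineDerivAt_const_mul (c 0) (lineDerivAt_mul_const (y 0) (lineDerivAt_mul dl dt)))
    (lineDerivAt_mul_const (sdot y c) (lineDerivAt_mul (lineDerivAt_add dm
      (lineDerivAt_mul_const (rootZ j y) (lineDerivAt_const_mul
        ((2 * j + 2) / ((2 * j + 4) * (2 * j + 3))) dk))) dt)))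
    (lineDerivAt_mul (lineDerivAt_mul_const (sdot y y)
      (lineDerivAt_add (lineDerivAt_mul_const (2 : ℝ)⁻¹ dm)
        (lineDerivAt_mul_const (rootZ j y) (lineDerivAt_const_mul (1 / (2 * j + 4)) dk)))) dc)
  simp only [← div_eq_mul_inv] at h
  refine lineDerivAt_congr h ?_
  simp only [sprayFormX]
  ring

lemma lineDerivAt_sprayForm_right (hu : y 0 ≠ 0) (hN : sdot y y ≠ 0) (c v : Coord n) :
    HasLineDerivAt ℝ (fun y => sprayForm j lam mu kap x y c)
      (sprayFormY j lam mu kap x y c v) y v := by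
  have dz := lineDerivAt_rootZ (j := j) hu hN v
  have dt := lineDerivAt_sdot_right y v x
  have dc := lineDerivAt_sdot_left y v c
  have h := lineDerivAt_sub (lineDerivAt_add
    (lineDerivAt_const_mul (c 0) (lineDerivAt_mul
      (lineDerivAt_const_mul (lam (spatialNorm x)) dt) (lineDerivAt_apply y v 0)))
    (lineDerivAt_mul (lineDerivAt_mul (lineDerivAt_add (lineDerivAt_const (mu (spatialNorm x)))
      (lineDerivAt_const_mul ((2 * j + 2) / ((2 * j + 4) * (2 * j + 3)) * kap (spatialNorm x)) dz))
      dt) dc))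
    (lineDerivAt_mul_const (sdot x c) (lineDerivAt_mul
      (lineDerivAt_add (lineDerivAt_const (mu (spatialNorm x) / 2))
        (lineDerivAt_const_mul (1 / (2 * j + 4) * kap (spatialNorm x)) dz))
      (lineDerivAt_sdot_self y v)))
  refine lineDerivAt_congr h ?_
  simp only [sprayFormY]
  ring

lemma lineDerivAt_sprayDiv_left (hx : spatialNorm x ≠ 0)
    (hl : DifferentiableAt ℝ lam (spatialNorm x)) (hm : DifferentiableAt ℝ mu (spatialNorm x))
    (hk : DifferentiableAt ℝ kap (spatialNorm x)) (v : Coord n) :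
    HasLineDerivAt ℝ (fun x => sprayDiv j lam mu kap x y) (sprayDivX j lam mu kap x y v) x v := by
  have dl := lineDerivAt_radial hx hl.hasDerivAt v
  have dm := lineDerivAt_radial hx hm.hasDerivAt v
  have dk := lineDerivAt_radial hx hk.hasDerivAt v
  have h := lineDerivAt_mul (lineDerivAt_add (lineDerivAt_add dl
    (lineDerivAt_const_mul (n : ℝ) dm)) (lineDerivAt_mul_const (rootZ j y)
      (lineDerivAt_const_mul (n * ((2 * j + 2) / ((2 * j + 4) * (2 * j + 3)))) dk)))
    (lineDerivAt_sdot_left x v y)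
  refine lineDerivAt_congr h ?_
  simp only [sprayDivX]
  ring

lemma lineDerivAt_sprayDiv_right (hu : y 0 ≠ 0) (hN : sdot y y ≠ 0) (v : Coord n) :
    HasLineDerivAt ℝ (fun y => sprayDiv j lam mu kap x y) (sprayDivY j lam mu kap x y v) y v := by
  have dz := lineDerivAt_rootZ (j := j) hu hN v
  have h := lineDerivAt_mul (lineDerivAt_add (lineDerivAt_const
    (lam (spatialNorm x) + n * mu (spatialNorm x)))
      (lineDerivAt_const_mul (n * ((2 * j + 2) / ((2 * j + 4) * (2 * j + 3)))
        * kap (spatialNorm x)) dz)) (lineDerivAt_sdot_right y v x)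
  refine lineDerivAt_congr h ?_
  simp only [sprayDivY]
  ring

/-- The terms of Gⁱ along x contribute through differentiation of N and Z. The two fractions in
`rootKap`'s multiples are such that these contributions cancel, leaving W a multiple of t = ⟨x̄, ȳ⟩
with factor n in front of μ and κZ. -/
lemma sum_sprayFormY_std (hN : sdot y y ≠ 0) :
    ∑ C, sprayFormY j lam mu kap x y (std C) (std C) = sprayDiv j lam mu kap x y := by
  have h0 : sprayFormY j lam mu kap x y (std 0) (std 0) = lam (spatialNorm x) * sdot x y := by
    simp [sprayFormY]
  have h : ∀ i : Fin n, sprayFormY j lam mu kap x y (std i.succ) (std i.succ) =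
      ((2 * j + 2) / ((2 * j + 4) * (2 * j + 3)) + (1 / (2 * j + 4)) * (2 * j + 2))
        * kap (spatialNorm x) * rootZ j y * (x i.succ * y i.succ)
      - (2 * j + 4) * ((2 * j + 2) / ((2 * j + 4) * (2 * j + 3))) * kap (spatialNorm x)
        * rootZ j y * sdot x y / sdot y y * (y i.succ * y i.succ)
      + (mu (spatialNorm x) + (2 * j + 2) / ((2 * j + 4) * (2 * j + 3)) * kap (spatialNorm x)
        * rootZ j y) * sdot x y := fun i => by
    simp only [sprayFormY, rootZY, sdot_std_succ, std_succ_apply_zero, Pi.single_eq_same]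
    field_simp
    ring
  rw [Fin.sum_univ_succ, h0, Finset.sum_congr rfl fun i _ => h i, Finset.sum_add_distrib,
    Finset.sum_sub_distrib, ← Finset.mul_sum, ← Finset.mul_sum, ← sdot, ← sdot]
  simp only [Finset.sum_const, Finset.card_univ, Fintype.card_fin, nsmul_eq_mul, sprayDiv]
  field_simp
  ring

lemma sum_sprayFormX_std (hx : spatialNorm x ≠ 0) :
    ∑ C, sprayFormX j lam mu kap x y (std C) (std C) =
      (deriv mu (spatialNorm x) + (2 * j + 2) / ((2 * j + 4) * (2 * j + 3))
        * deriv kap (spatialNorm x) * rootZ j y) / spatialNorm x * sdot x y ^ 2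
      + (mu (spatialNorm x) + (2 * j + 2) / ((2 * j + 4) * (2 * j + 3)) * kap (spatialNorm x)
        * rootZ j y) * sdot y y
      - sdot y y * ((deriv mu (spatialNorm x) / 2 + 1 / (2 * j + 4)
        * deriv kap (spatialNorm x) * rootZ j y) * spatialNorm x
      + n * (mu (spatialNorm x) / 2 + 1 / (2 * j + 4) * kap (spatialNorm x) * rootZ j y)) := by
  have h0 : sprayFormX j lam mu kap x y (std 0) (std 0) = 0 := by
    simp [sprayFormX]
  have h : ∀ i : Fin n, sprayFormX j lam mu kap x y (std i.succ) (std i.succ) =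
      (deriv mu (spatialNorm x) + (2 * j + 2) / ((2 * j + 4) * (2 * j + 3))
        * deriv kap (spatialNorm x) * rootZ j y) / spatialNorm x * sdot x y
        * (x i.succ * y i.succ)
      + (mu (spatialNorm x) + (2 * j + 2) / ((2 * j + 4) * (2 * j + 3)) * kap (spatialNorm x)
        * rootZ j y) * (y i.succ * y i.succ)
      - sdot y y * ((deriv mu (spatialNorm x) / 2 + 1 / (2 * j + 4)
        * deriv kap (spatialNorm x) * rootZ j y) / spatialNorm x) * (x i.succ * x i.succ)
      - sdot y y * (mu (spatialNorm x) / 2 + 1 / (2 * j + 4) * kap (spatialNorm x)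
        * rootZ j y) := fun i => by
    simp only [sprayFormX, sdot_std_succ, std_succ_sdot, std_succ_apply_zero, Pi.single_eq_same]
    ring
  rw [Fin.sum_univ_succ, h0, Finset.sum_congr rfl fun i _ => h i, Finset.sum_sub_distrib,
    Finset.sum_sub_distrib, Finset.sum_add_distrib, ← Finset.mul_sum, ← Finset.mul_sum,
    ← Finset.mul_sum, ← sdot, ← sdot, ← sdot, ← spatialNorm_sq x]
  simp only [Finset.sum_const, Finset.card_univ, Fintype.card_fin, nsmul_eq_mul]
  field_simp
  ring

lemma sum_sprayDivX_std_mul (w : Coord n) :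
    ∑ A, sprayDivX j lam mu kap x y (std A) * w A = sprayDivX j lam mu kap x y w := by
  have h : ∀ A, sprayDivX j lam mu kap x y (std A) * w A =
      (deriv lam (spatialNorm x) + n * deriv mu (spatialNorm x)
        + n * ((2 * j + 2) / ((2 * j + 4) * (2 * j + 3))) * deriv kap (spatialNorm x) * rootZ j y)
        / spatialNorm x * sdot x y * (sdot x (std A) * w A)
      + (lam (spatialNorm x) + n * mu (spatialNorm x)
        + n * ((2 * j + 2) / ((2 * j + 4) * (2 * j + 3))) * kap (spatialNorm x) * rootZ j y)
        * (sdot y (std A) * w A) := fun A => by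
    rw [sprayDivX, sdot_comm (std A) y]; ring
  simp only [h, Finset.sum_add_distrib, ← Finset.mul_sum, sum_sdot_std_mul]
  rw [sprayDivX, sdot_comm w y]; ring

lemma sum_sprayDivY_std_mul (w : Coord n) :
    ∑ A, w A * sprayDivY j lam mu kap x y (std A) = sprayDivY j lam mu kap x y w := by
  have h : ∀ A, w A * sprayDivY j lam mu kap x y (std A) =
      n * ((2 * j + 2) / ((2 * j + 4) * (2 * j + 3))) * kap (spatialNorm x)
        * ((2 * j + 4) * rootZ j y) / y 0 * sdot x y * (std A 0 * w A)
      - n * ((2 * j + 2) / ((2 * j + 4) * (2 * j + 3))) * kap (spatialNorm x)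
        * ((2 * j + 4) * rootZ j y) / sdot y y * sdot x y * (sdot y (std A) * w A)
      + (lam (spatialNorm x) + n * mu (spatialNorm x)
        + n * ((2 * j + 2) / ((2 * j + 4) * (2 * j + 3))) * kap (spatialNorm x) * rootZ j y)
        * (sdot x (std A) * w A) := fun A => by
    rw [sprayDivY, rootZY]; ring
  simp only [h, Finset.sum_add_distrib, Finset.sum_sub_distrib, ← Finset.mul_sum,
    sum_sdot_std_mul, sum_std_zero_mul]
  rw [sprayDivY, rootZY]; ring

lemma sum_sum_sprayFormY_std (hu : y 0 ≠ 0) (hN : sdot y y ≠ 0) {P Q : ℝ}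
    (hP : P = mu (spatialNorm x) + (2 * j + 2) / ((2 * j + 4) * (2 * j + 3)) * kap (spatialNorm x)
      * rootZ j y)
    (hQ : Q = mu (spatialNorm x) / 2 + 1 / (2 * j + 4) * kap (spatialNorm x) * rootZ j y) :
    ∑ C, ∑ A, sprayFormY j lam mu kap x y (std C) (std A)
        * sprayFormY j lam mu kap x y (std A) (std C) =
      lam (spatialNorm x) ^ 2 * sdot x y ^ 2
      + 2 * lam (spatialNorm x) * kap (spatialNorm x) * rootZ j y
        * ((2 * j + 2) / (2 * j + 3) * sdot x y ^ 2 - sdot x x * sdot y y)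
      + (n * (sdot x y * P) ^ 2 + 2 * (sdot x y * P) * ((P + (kap (spatialNorm x) * rootZ j y - 2 * Q))
          * sdot x y - (2 * j + 2) / (2 * j + 3) * kap (spatialNorm x) * rootZ j y * sdot x y)
        + (P ^ 2 + (kap (spatialNorm x) * rootZ j y - 2 * Q) ^ 2) * sdot x y ^ 2
        + ((2 * j + 2) / (2 * j + 3) * kap (spatialNorm x) * rootZ j y * sdot x y) ^ 2
        + 2 * P * (kap (spatialNorm x) * rootZ j y - 2 * Q) * sdot x x * sdot y y
        - 2 * (P + (kap (spatialNorm x) * rootZ j y - 2 * Q)) * ((2 * j + 2) / (2 * j + 3)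
          * kap (spatialNorm x) * rootZ j y * sdot x y) * sdot x y) := by
  have h3 : (2 * j : ℝ) + 3 ≠ 0 := by positivity
  have h4 : (2 * j : ℝ) + 4 ≠ 0 := by positivity
  have h00 : sprayFormY j lam mu kap x y (std 0) (std 0) = lam (spatialNorm x) * sdot x y := by
    simp [sprayFormY]
  have h0 : ∀ i : Fin n, sprayFormY j lam mu kap x y (std 0) (std i.succ)
      * sprayFormY j lam mu kap x y (std i.succ) (std 0) =
      lam (spatialNorm x) * kap (spatialNorm x) * rootZ j y * ((2 * j + 2) / (2 * j + 3)) * sdot x y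
        * (x i.succ * y i.succ)
      - lam (spatialNorm x) * kap (spatialNorm x) * rootZ j y * sdot y y
        * (x i.succ * x i.succ) := fun i => by
    simp only [sprayFormY, rootZY, sdot_std_succ, std_succ_apply_zero, Pi.single_eq_same,
      sdot_std_zero, show (std 0 : Coord n) i.succ = 0 by simp]
    field_simp
    ring
  -- The spatial block in the form required by `sum_sum_trace_sq`: α = tP, β = P, γ = κZ − 2Q. The
  -- last coefficient ε, with its 1/N, comes from differentiating Z in the term along y.
  have hs : ∀ i l : Fin n, sprayFormY j lam mu kap x y (std i.succ) (std l.succ) =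
      (sdot x y * P) * (if i = l then 1 else 0) + P * (y i.succ * x l.succ)
        + (kap (spatialNorm x) * rootZ j y - 2 * Q) * (x i.succ * y l.succ)
        + -((2 * j + 2) / (2 * j + 3) * kap (spatialNorm x) * rootZ j y * sdot x y / sdot y y)
          * (y i.succ * y l.succ) := fun i l => by
    have e : (std l.succ : Coord n) i.succ = if i = l then 1 else 0 := by
      simp [Pi.single_apply]
    simp only [sprayFormY, rootZY, sdot_std_succ, std_succ_apply_zero, e, ← hP, ← hQ]
    field_simp
    ring
  rw [Fin.sum_univ_succ]
  simp only [Fin.sum_univ_succ (n := n)]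
  rw [Finset.sum_add_distrib]
  simp only [hs, sum_sum_trace_sq]
  simp only [mul_comm (sprayFormY j lam mu kap x y (std (Fin.succ _)) (std 0)), h0, h00]
  simp only [Finset.sum_sub_distrib, ← Finset.mul_sum, ← sdot.eq_1]
  field_simp
  ring

end Derivatives

/-! ### The Ricci curvature of a root metric -/

namespace IsRootMetric
variable (h : IsRootMetric I j a b L)
include h

lemma smooth_rootLam : ContDiffOn ℝ ∞ (rootLam j a) I :=
  (h.smooth_a.deriv_of_isOpen h.isOpen (by simp)).div
    ((contDiffOn_const.mul h.smooth_a).mul contDiffOn_id) fun ρ hρ =>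
      mul_ne_zero (mul_ne_zero (by positivity) (h.a_pos ρ hρ).ne') (h.subset_Ioi hρ).ne'

lemma smooth_rootMu : ContDiffOn ℝ ∞ (rootMu j b) I :=
  (h.smooth_b.deriv_of_isOpen h.isOpen (by simp)).div
    ((contDiffOn_const.mul h.smooth_b).mul contDiffOn_id) fun ρ hρ =>
      mul_ne_zero (mul_ne_zero (by positivity) (h.b_ne ρ hρ)) (h.subset_Ioi hρ).ne'

lemma smooth_rootKap : ContDiffOn ℝ ∞ (rootKap a b) I :=
  (h.smooth_a.deriv_of_isOpen h.isOpen (by simp)).div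
    ((contDiffOn_const.mul h.smooth_b).mul contDiffOn_id) fun ρ hρ =>
      mul_ne_zero (mul_ne_zero (by positivity) (h.b_ne ρ hρ)) (h.subset_Ioi hρ).ne'

lemma smooth_sprayForm (c : Coord n) :
    ContDiffOn ℝ ∞ (fun p : Coord n × Coord n =>
      sprayForm j (rootLam j a) (rootMu j b) (rootKap a b) p.1 p.2 c) (rootDomain n I j a b) := by
  intro p hp
  have hl := contDiffAt_radial h.isOpen h.subset_Ioi (h.smooth_rootLam (j := j)) hp.1
  have hm := contDiffAt_radial h.isOpen h.subset_Ioi (h.smooth_rootMu (j := j)) hp.1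
  have hk := contDiffAt_radial h.isOpen h.subset_Ioi h.smooth_rootKap hp.1
  have hN : ContDiffAt ℝ ∞ (fun p : Coord n × Coord n => sdot p.2 p.2) p :=
    (contDiff_sdot contDiff_snd contDiff_snd).contDiffAt
  have ht : ContDiffAt ℝ ∞ (fun p : Coord n × Coord n => sdot p.1 p.2) p :=
    (contDiff_sdot contDiff_fst contDiff_snd).contDiffAt
  have hx : ContDiffAt ℝ ∞ (fun p : Coord n × Coord n => sdot p.1 c) p :=
    (contDiff_sdot contDiff_fst contDiff_const).contDiffAt
  have hy : ContDiffAt ℝ ∞ (fun p : Coord n × Coord n => sdot p.2 c) p :=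
    (contDiff_sdot contDiff_snd contDiff_const).contDiffAt
  have hu : ContDiffAt ℝ ∞ (fun p : Coord n × Coord n => p.2 0) p := by fun_prop
  have hZ : ContDiffAt ℝ ∞ (fun p : Coord n × Coord n => rootZ j p.2) p :=
    (hu.pow _).div (hN.pow _) (pow_ne_zero _ hp.2.2.1)
  exact (((contDiffAt_const.mul ((hl.mul ht).mul hu)).add
    (((hm.add ((contDiffAt_const.mul hk).mul hZ)).mul ht).mul hy)).sub
    ((((hm.div_const 2).add ((contDiffAt_const.mul hk).mul hZ)).mul hN).mul hx)).contDiffWithinAt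

lemma differentiableAt_coeff {f : ℝ → ℝ} (hf : ContDiffOn ℝ ∞ f I) {ρ : ℝ} (hρ : ρ ∈ I) :
    DifferentiableAt ℝ f ρ :=
  (hf.contDiffAt (h.isOpen.mem_nhds hρ)).differentiableAt (by simp)

/-- The Ricci curvature, in terms of `ρ = |x̄|`, `t = ⟨x̄, ȳ⟩`, `N = |ȳ|²` and `Z = z^m`. -/
lemma ricci_eq {x y : Coord n} (hp : (x, y) ∈ rootDomain n I j a b)
    {ρ t N Z l m k l' m' k' p P Q P' Q' W W' : ℝ}
    (hρ : ρ = spatialNorm x) (ht : t = sdot x y) (hN : N = sdot y y) (hZ : Z = rootZ j y)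
    (hl : l = rootLam j a ρ) (hm : m = rootMu j b ρ) (hk : k = rootKap a b ρ)
    (hl' : l' = deriv (rootLam j a) ρ) (hm' : m' = deriv (rootMu j b) ρ)
    (hk' : k' = deriv (rootKap a b) ρ) (hpj : p = (2 * j + 2) / ((2 * j + 4) * (2 * j + 3)))
    (hP : P = m + p * k * Z) (hQ : Q = m / 2 + 1 / (2 * j + 4) * k * Z)
    (hP' : P' = m' + p * k' * Z) (hQ' : Q' = m' / 2 + 1 / (2 * j + 4) * k' * Z)
    (hW : W = l + n * m + n * p * k * Z) (hW' : W' = l' + n * m' + n * p * k' * Z) :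
    ricci L x y = 2 * (P' / ρ * t ^ 2 + P * N - N * (Q' * ρ + n * Q))
      - (W' / ρ * t ^ 2 + W * N)
      + 2 * (n * p * k * ((2 * j + 4) * Z) * (l - (P - Q)) * t ^ 2
        + W * (P * t ^ 2 - Q * N * ρ ^ 2))
      - (l ^ 2 * t ^ 2 + 2 * l * k * Z * ((2 * j + 2) / (2 * j + 3) * t ^ 2 - ρ ^ 2 * N)
        + (n * (t * P) ^ 2 + 2 * (t * P) * ((P + (k * Z - 2 * Q)) * t
            - (2 * j + 2) / (2 * j + 3) * k * Z * t)
          + (P ^ 2 + (k * Z - 2 * Q) ^ 2) * t ^ 2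
          + ((2 * j + 2) / (2 * j + 3) * k * Z * t) ^ 2
          + 2 * P * (k * Z - 2 * Q) * ρ ^ 2 * N
          - 2 * (P + (k * Z - 2 * Q)) * ((2 * j + 2) / (2 * j + 3) * k * Z * t) * t)) := by
  have hx := h.spatialNorm_ne hp
  have dl := h.differentiableAt_coeff (h.smooth_rootLam (j := j)) hp.1
  have dm := h.differentiableAt_coeff (h.smooth_rootMu (j := j)) hp.1
  have dk := h.differentiableAt_coeff h.smooth_rootKap hp.1
  have hY : ∀ C A x y, (x, y) ∈ rootDomain n I j a b →
      dY (fun x y => sprayForm j (rootLam j a) (rootMu j b) (rootKap a b) x y (std C)) A x y =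
      sprayFormY j (rootLam j a) (rootMu j b) (rootKap a b) x y (std C) (std A) :=
    fun C A x y hp => dY_eq_of (lineDerivAt_sprayForm_right hp.2.1 hp.2.2.1 _ _)
  have hr := ricci_eq_of_spray h.isOpen_domain
    (G := fun C x y => sprayForm j (rootLam j a) (rootMu j b) (rootKap a b) x y (std C))
    (W := sprayDiv j (rootLam j a) (rootMu j b) (rootKap a b))
    (fun C x y hp => h.spray_eq hp C) (fun C => h.smooth_sprayForm (std C))
    (fun x y hp => by
      simp only [hY _ _ x y hp]
      exact sum_sprayFormY_std hp.2.2.1) hp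
  have hX : ∀ C,
      dX (fun x y => sprayForm j (rootLam j a) (rootMu j b) (rootKap a b) x y (std C)) C x y =
      sprayFormX j (rootLam j a) (rootMu j b) (rootKap a b) x y (std C) (std C) :=
    fun C => dX_eq_of (lineDerivAt_sprayForm_left hx dl dm dk _ _)
  have hDX : ∀ A, dX (sprayDiv j (rootLam j a) (rootMu j b) (rootKap a b)) A x y =
      sprayDivX j (rootLam j a) (rootMu j b) (rootKap a b) x y (std A) :=
    fun A => dX_eq_of (lineDerivAt_sprayDiv_left hx dl dm dk _)
  have hDY : ∀ A, dY (sprayDiv j (rootLam j a) (rootMu j b) (rootKap a b)) A x y =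
      sprayDivY j (rootLam j a) (rootMu j b) (rootKap a b) x y (std A) :=
    fun A => dY_eq_of (lineDerivAt_sprayDiv_right hp.2.1 hp.2.2.1 _)
  have hPP : P = rootMu j b (spatialNorm x) + (2 * j + 2) / ((2 * j + 4) * (2 * j + 3))
      * rootKap a b (spatialNorm x) * rootZ j y := by rw [hP, hm, hk, hpj, hZ, hρ]
  have hQQ : Q = rootMu j b (spatialNorm x) / 2 + 1 / (2 * j + 4)
      * rootKap a b (spatialNorm x) * rootZ j y := by rw [hQ, hm, hk, hZ, hρ]
  simp only [hX, hDX, hDY, hY _ _ _ _ hp, sum_sprayFormX_std hx, sum_sprayDivX_std_mul,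
    sum_sum_sprayFormY_std hp.2.1 hp.2.2.1 hPP hQQ] at hr
  -- The contraction of G with the fibre derivative of W is that derivative in the direction of the
  -- vector G, so `sdot_sprayForm` evaluates it.
  rw [sum_sprayDivY_std_mul
    (fun A => sprayForm j (rootLam j a) (rootMu j b) (rootKap a b) x y (std A))] at hr
  simp only [sprayDivX, sprayDivY, rootZY, sdot_sprayForm, sprayForm_std_zero] at hr
  rw [hr, ← spatialNorm_sq x, sdot_comm y x]
  simp only [← hρ, ← ht, ← hN, ← hZ, ← hl, ← hm, ← hk, ← hl', ← hm', ← hk', ← hpj]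
  have e1 : N ≠ 0 := hN ▸ hp.2.2.1
  have e2 : ρ ≠ 0 := hρ ▸ hx
  have hu := hp.2.1
  -- The logarithmic derivative of Z along G contains G⁰/y⁰; since G⁰ = λ t y⁰, the variable y⁰
  -- survives only inside Z.
  have e3 : l * t * y 0 / y 0 = l * t := by field_simp
  simp only [← hP, ← hQ, ← hP', ← hQ', ← hW, ← hW', e3]
  have e4 : (P * t * N - Q * N * t) / N = (P - Q) * t := by field_simp
  rw [e4]
  field_simp

end IsRootMetric

/-! ### Ricci-flatness -/

lemma spatialNorm_smul_std {ρ : ℝ} (hρ : 0 < ρ) (i : Fin n) :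
    spatialNorm (ρ • (std i.succ : Coord n)) = ρ := by
  rw [spatialNorm_smul hρ.le, spatialNorm_eq_sqrt]
  simp

/-- The second difference at three consecutive points equals 2c₂. -/
lemma quadratic_coeff_eq_zero {c₀ c₁ c₂ r : ℝ}
    (h : ∀ z, r < z → c₀ + c₁ * z + c₂ * z ^ 2 = 0) : c₂ = 0 := by
  have h1 := h (r + 1) (by linarith)
  have h2 := h (r + 2) (by linarith)
  have h3 := h (r + 3) (by linarith)
  linear_combination (h1 - 2 * h2 + h3) / 2

/-- The hypothesis is the Ricci formula at t = ρ, N = 1 with Z = z free, and only its z² coefficient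
is extracted. The coefficients are kept as independent letters so that the polynomial identity stays
small. -/
lemma radial_ricci_coeff {ρ n M l m k m' w w' K K' R R' V V' S q r : ℝ}
    (h : ∀ z, r < z →
      2 * ((m' + K' * z) / ρ * ρ ^ 2 + (m + K * z) * 1
        - 1 * ((m' / 2 + R' * z) * ρ + n * (m / 2 + R * z)))
      - ((w' + V' * z) / ρ * ρ ^ 2 + (w + V * z) * 1)
      + 2 * (V * (M * z) * (l - ((m + K * z) - (m / 2 + R * z))) * ρ ^ 2
        + (w + V * z) * ((m + K * z) * ρ ^ 2 - (m / 2 + R * z) * 1 * ρ ^ 2))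
      - (l ^ 2 * ρ ^ 2 + 2 * l * k * z * (q * ρ ^ 2 - ρ ^ 2 * 1)
        + (n * (ρ * (m + K * z)) ^ 2
          + 2 * (ρ * (m + K * z)) * (((m + K * z) + (k * z - 2 * (m / 2 + R * z))) * ρ
            - S * z * ρ)
          + ((m + K * z) ^ 2 + (k * z - 2 * (m / 2 + R * z)) ^ 2) * ρ ^ 2
          + (S * z * ρ) ^ 2
          + 2 * (m + K * z) * (k * z - 2 * (m / 2 + R * z)) * ρ ^ 2 * 1
          - 2 * ((m + K * z) + (k * z - 2 * (m / 2 + R * z))) * (S * z * ρ) * ρ)) = 0) :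
    (2 * (V * (1 - M) * (K - R)) - (n * K ^ 2 + 2 * K * (K + k - 2 * R - S)
      + (K + k - 2 * R - S) ^ 2)) * ρ ^ 2 = 0 := by
  refine quadratic_coeff_eq_zero (r := r)
    (c₀ := 2 * (m' / ρ * ρ ^ 2 + m - (m' / 2 * ρ + n * (m / 2))) - (w' / ρ * ρ ^ 2 + w)
      + 2 * w * (m / 2) * ρ ^ 2 - l ^ 2 * ρ ^ 2 - n * m ^ 2 * ρ ^ 2)
    (c₁ := 2 * (K' / ρ * ρ ^ 2 + K - (R' * ρ + n * R)) - (V' / ρ * ρ ^ 2 + V)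
      + 2 * (V * M * (l - m / 2) * ρ ^ 2 + w * (K - R) * ρ ^ 2 + V * (m / 2) * ρ ^ 2)
      - (2 * l * k * (q * ρ ^ 2 - ρ ^ 2) + n * 2 * m * K * ρ ^ 2
        + 2 * m * (K + k - 2 * R - S) * ρ ^ 2))
    fun z hz => ?_
  rw [← h z hz]
  ring

namespace IsRootMetric
variable (h : IsRootMetric I j a b L)
include h

/-- Test points: x̄ along one axis, ȳ a unit vector along an axis, and y⁰ = z^{1/m}, so that Z takes
any large value z. Choosing l = i or l ≠ i makes ȳ parallel or orthogonal to x̄. -/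
lemma exists_direction {ρ : ℝ} (hρ : ρ ∈ I) (i l : Fin n) {z : ℝ} (hz : |b ρ / a ρ| < z) :
    ∃ u : ℝ, (ρ • std i.succ, u • std 0 + std l.succ) ∈ rootDomain n I j a b ∧
      rootZ j (u • std 0 + std l.succ : Coord n) = z := by
  have hz0 : 0 < z := (abs_nonneg _).trans_lt hz
  have hρ0 : 0 < ρ := h.subset_Ioi hρ
  have ha := h.a_pos ρ hρ
  have hu : (z ^ ((2 * j + 4 : ℕ) : ℝ)⁻¹) ^ (2 * j + 4) = z :=
    Real.rpow_inv_natCast_pow hz0.le (by omega)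
  have e0 : (z ^ ((2 * j + 4 : ℕ) : ℝ)⁻¹ • std 0 + std l.succ : Coord n) 0
      = z ^ ((2 * j + 4 : ℕ) : ℝ)⁻¹ := by simp
  have eN : sdot (z ^ ((2 * j + 4 : ℕ) : ℝ)⁻¹ • std 0 + std l.succ : Coord n)
      (z ^ ((2 * j + 4 : ℕ) : ℝ)⁻¹ • std 0 + std l.succ) = 1 := by
    simp [sdot_add_right, sdot_smul_right]
  refine ⟨z ^ ((2 * j + 4 : ℕ) : ℝ)⁻¹, ⟨?_, ?_, ?_, ?_⟩, ?_⟩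
  · simpa only [spatialNorm_smul_std hρ0] using hρ
  · simp only [e0]
    exact (Real.rpow_pos_of_pos hz0 _).ne'
  · simp only [eN]
    exact one_ne_zero
  · simp only [rootS, e0, eN, spatialNorm_smul_std hρ0, hu, one_pow, mul_one]
    -- Here S = az + b, and z > |b/a| makes it positive even when b is negative.
    have := (abs_lt.1 hz).1
    rw [lt_div_iff₀ ha] at this
    nlinarith
  · rw [rootZ, e0, eN, hu]
    simp

lemma rootKap_eq_zero (hn : 1 ≤ n) (hflat : RicciFlatOn (rootDomain n I j a b) L) {ρ : ℝ}
    (hρ : ρ ∈ I) : rootKap a b ρ = 0 := by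
  have hρ0 : 0 < ρ := h.subset_Ioi hρ
  have h3 : (2 * j : ℝ) + 3 ≠ 0 := by positivity
  have h4 : (2 * j : ℝ) + 4 ≠ 0 := by positivity
  let i : Fin n := ⟨0, hn⟩
  -- For the actual coefficients K + κ − 2R − S = 0, so the z² coefficient collapses to 2V(1−m)(K−R)
  -- − nK², which equals n(m−2)κ²/(m(m−1)²). It is a nonzero multiple of κ² since m > 2 and n ≥ 1.
  have key : n * ((2 * j + 2) / ((2 * j + 4) * (2 * j + 3))) / (2 * j + 3)
      * rootKap a b ρ ^ 2 * ρ ^ 2 = 0 := by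
    have key := radial_ricci_coeff (ρ := ρ) (n := n) (M := 2 * j + 4) (l := rootLam j a ρ)
      (m := rootMu j b ρ) (k := rootKap a b ρ) (m' := deriv (rootMu j b) ρ)
      (w := rootLam j a ρ + n * rootMu j b ρ)
      (w' := deriv (rootLam j a) ρ + n * deriv (rootMu j b) ρ)
      (K := (2 * j + 2) / ((2 * j + 4) * (2 * j + 3)) * rootKap a b ρ)
      (K' := (2 * j + 2) / ((2 * j + 4) * (2 * j + 3)) * deriv (rootKap a b) ρ)
      (R := 1 / (2 * j + 4) * rootKap a b ρ) (R' := 1 / (2 * j + 4) * deriv (rootKap a b) ρ)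
      (V := n * ((2 * j + 2) / ((2 * j + 4) * (2 * j + 3))) * rootKap a b ρ)
      (V' := n * ((2 * j + 2) / ((2 * j + 4) * (2 * j + 3))) * deriv (rootKap a b) ρ)
      (S := (2 * j + 2) / (2 * j + 3) * rootKap a b ρ) (q := (2 * j + 2) / (2 * j + 3))
      (r := |b ρ / a ρ|) fun z hz => by
        obtain ⟨u, hu, hz⟩ := h.exists_direction hρ i i hz
        have h1 := hflat _ hu
        simp only at h1
        rw [h.ricci_eq hu (spatialNorm_smul_std hρ0 i).symm (t := ρ) (N := 1)
          (by simp [sdot_add_right, sdot_smul_right])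
          (by simp [sdot_add_right, sdot_smul_right])
          hz.symm rfl rfl rfl rfl rfl rfl rfl rfl rfl rfl rfl rfl rfl] at h1
        exact h1
    rw [← key]
    field_simp
    ring
  have hn' : (n : ℝ) ≠ 0 := by positivity
  have h2 : (2 * j : ℝ) + 2 ≠ 0 := by positivity
  simpa [hn', h2, h3, h4, hρ0.ne'] using key

lemma deriv_a_eq_zero (hn : 1 ≤ n) (hflat : RicciFlatOn (rootDomain n I j a b) L) {ρ : ℝ}
    (hρ : ρ ∈ I) : deriv a ρ = 0 := by
  have := h.rootKap_eq_zero hn hflat hρ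
  have hρ0 : 0 < ρ := h.subset_Ioi hρ
  simpa [rootKap, h.b_ne ρ hρ, hρ0.ne'] using this

lemma deriv_eq_zero_of_eqOn_zero {f : ℝ → ℝ} (hf : ∀ ρ ∈ I, f ρ = 0) {ρ : ℝ} (hρ : ρ ∈ I) :
    deriv f ρ = 0 := by
  have : f =ᶠ[𝓝 ρ] fun _ => 0 := by
    filter_upwards [h.isOpen.mem_nhds hρ] with r hr using hf r hr
  rw [this.deriv_eq, deriv_const]

/-- Constant a makes λ and κ vanish identically, together with their derivatives. What remains is
the Ricci curvature of |b|^{2/m}|dx̄|², whose logarithmic conformal factor σ satisfies σ' = ρμ. -/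
lemma ricci_eq_of_deriv_a_eq_zero (ha : ∀ ρ ∈ I, deriv a ρ = 0) {x y : Coord n}
    (hp : (x, y) ∈ rootDomain n I j a b) {ρ m m' : ℝ}
    (hρ : ρ = spatialNorm x) (hm : m = rootMu j b ρ) (hm' : m' = deriv (rootMu j b) ρ) :
    ricci L x y = sdot y y * ((2 - 2 * n) * m - ρ * m' - (n - 2) * ρ ^ 2 * m ^ 2)
      - (n - 2) * sdot x y ^ 2 * (m' / ρ - m ^ 2) := by
  have hI : ρ ∈ I := hρ ▸ hp.1
  have k0 : ∀ ρ ∈ I, rootKap a b ρ = 0 := fun r hr => by simp [rootKap, ha r hr]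
  have l0 : ∀ ρ ∈ I, rootLam j a ρ = 0 := fun r hr => by simp [rootLam, ha r hr]
  have e2 : ρ ≠ 0 := (h.subset_Ioi hI).ne'
  rw [h.ricci_eq hp hρ rfl rfl rfl (l0 ρ hI).symm hm (k0 ρ hI).symm
    (h.deriv_eq_zero_of_eqOn_zero l0 hI).symm hm' (h.deriv_eq_zero_of_eqOn_zero k0 hI).symm
    rfl rfl rfl rfl rfl rfl rfl]
  field_simp
  ring

end IsRootMetric

/-! ### Differential equations for b and the criteria for Ricci-flatness -/

namespace IsRootMetric
variable (h : IsRootMetric I j a b L)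
include h

/-- The Ricci form is a combination of N and t². Directions orthogonal to x̄ isolate the N
coefficient, and parallel ones then give the t² coefficient. A second axis is needed, hence n ≥ 2.
When n = 2 the t² term is absent and only the first equation survives. -/
lemma rootMu_equations (hn : 2 ≤ n) (hflat : RicciFlatOn (rootDomain n I j a b) L) {ρ : ℝ}
    (hρ : ρ ∈ I) :
    2 * rootMu j b ρ + ρ * deriv (rootMu j b) ρ = 0 ∧
      (3 ≤ n → 2 * rootMu j b ρ + ρ ^ 2 * rootMu j b ρ ^ 2 = 0) := by
  have hρ0 : 0 < ρ := h.subset_Ioi hρ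
  have ha : ∀ r ∈ I, deriv a r = 0 := fun r hr => h.deriv_a_eq_zero (by omega) hflat hr
  let i : Fin n := ⟨0, by omega⟩
  let l : Fin n := ⟨1, by omega⟩
  have hil : i ≠ l := by simp [i, l]
  have e1 : (2 - 2 * n) * rootMu j b ρ - ρ * deriv (rootMu j b) ρ
      - (n - 2) * ρ ^ 2 * rootMu j b ρ ^ 2 = 0 := by
    obtain ⟨u, hu, -⟩ := h.exists_direction hρ i l (lt_add_one _)
    have h1 := hflat _ hu
    simp only at h1
    rw [h.ricci_eq_of_deriv_a_eq_zero ha hu (spatialNorm_smul_std hρ0 i).symm rfl rfl] at h1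
    simpa [sdot_add_right, sdot_smul_right, hil, hil.symm] using h1
  have e2 : ((n : ℝ) - 2) * (deriv (rootMu j b) ρ - ρ * rootMu j b ρ ^ 2) = 0 := by
    obtain ⟨u, hu, -⟩ := h.exists_direction hρ i i (lt_add_one _)
    have h1 := hflat _ hu
    simp only at h1
    rw [h.ricci_eq_of_deriv_a_eq_zero ha hu (spatialNorm_smul_std hρ0 i).symm rfl rfl] at h1
    simp only [sdot_add_right, sdot_smul_right, sdot_std_zero, sdot_std_succ, Pi.add_apply,
      Pi.smul_apply, Pi.single_eq_same, smul_eq_mul, mul_zero, zero_add, mul_one,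
      show (std 0 : Coord n) i.succ = 0 by simp, e1] at h1
    have h2 : ρ * (((n : ℝ) - 2) * (deriv (rootMu j b) ρ - ρ * rootMu j b ρ ^ 2)) = 0 := by
      rw [← neg_eq_zero, ← h1]
      field_simp
      ring
    exact (mul_eq_zero.1 h2).resolve_left hρ0.ne'
  rcases eq_or_lt_of_le hn with rfl | hn'
  · refine ⟨?_, fun h => by omega⟩
    push_cast at e1
    linarith
  · have hn2 : ((n : ℝ) - 2) ≠ 0 := by
      have : (2 : ℝ) < n := by exact_mod_cast hn'
      linarith
    have hn1 : ((n : ℝ) - 1) ≠ 0 := by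
      have : (2 : ℝ) < n := by exact_mod_cast hn'
      linarith
    have e3 := (mul_eq_zero.1 e2).resolve_left hn2
    have e4 : ((n : ℝ) - 1) * (2 * rootMu j b ρ + ρ ^ 2 * rootMu j b ρ ^ 2) = 0 := by
      linear_combination -e1 - ρ * e3
    have e5 := (mul_eq_zero.1 e4).resolve_left hn1
    exact ⟨by linear_combination e5 + ρ * e3, fun _ => e5⟩

/-- The hypothesis on b means μ = c/ρ². The Ricci curvature then carries the factor (n − 2)c(c + 2),
which the three alternatives annihilate. The argument is pointwise, so I need not be connected. -/
lemma ricciFlat_of_log_deriv (ha : ∀ ρ ∈ I, deriv a ρ = 0) {c : ℝ}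
    (hc : n = 2 ∨ c = 0 ∨ c = -2) (hb : ∀ ρ ∈ I, ρ * deriv b ρ = (2 * j + 4) * c * b ρ) :
    RicciFlatOn (rootDomain n I j a b) L := by
  rintro ⟨x, y⟩ hp
  have hI : spatialNorm x ∈ I := hp.1
  have h4 : (2 * j : ℝ) + 4 ≠ 0 := by positivity
  have hm : ∀ ρ ∈ I, rootMu j b ρ = c / ρ ^ 2 := fun ρ hρ => by
    have h1 := h.b_ne ρ hρ
    have h2 : ρ ≠ 0 := (h.subset_Ioi hρ).ne'
    rw [rootMu]
    field_simp
    linear_combination hb ρ hρ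
  have hρ0 : spatialNorm x ≠ 0 := h.spatialNorm_ne hp
  have hm' : deriv (rootMu j b) (spatialNorm x) = -2 * c / spatialNorm x ^ 3 := by
    have e : rootMu j b =ᶠ[𝓝 (spatialNorm x)] fun ρ => c / ρ ^ 2 := by
      filter_upwards [h.isOpen.mem_nhds hI] with r hr using hm r hr
    rw [e.deriv_eq]
    have := ((hasDerivAt_const (spatialNorm x) c).div (hasDerivAt_pow 2 (spatialNorm x))
      (pow_ne_zero 2 hρ0)).deriv
    refine Eq.trans this ?_
    field_simp
    push_cast
    ring
  simp only
  rw [h.ricci_eq_of_deriv_a_eq_zero ha hp rfl (hm _ hI).symm hm'.symm]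
  have hz : ((n : ℝ) - 2) * (2 * c + c ^ 2) = 0 := by
    rcases hc with rfl | rfl | rfl <;> norm_num
  field_simp
  linear_combination (sdot x y ^ 2 - spatialNorm x ^ 2 * sdot y y) * hz

lemma ricciFlat_of_deriv_a_eq_zero (hn : n = 1) (ha : ∀ ρ ∈ I, deriv a ρ = 0) :
    RicciFlatOn (rootDomain n I j a b) L := by
  subst hn
  rintro ⟨x, y⟩ hp
  have hρ0 : spatialNorm x ≠ 0 := h.spatialNorm_ne hp
  -- Equality in Cauchy–Schwarz on a line makes the N and t² terms cancel for every b.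
  have ht : sdot x y ^ 2 = spatialNorm x ^ 2 * sdot y y := by
    rw [spatialNorm_sq]
    simp only [sdot, Fin.sum_univ_one]
    ring
  simp only
  rw [h.ricci_eq_of_deriv_a_eq_zero ha hp rfl rfl rfl, ht]
  field_simp
  push_cast
  ring

lemma ricciFlat_iff_of_two_le (hn : 2 ≤ n) (hI : IsPreconnected I) (hne : I.Nonempty) :
    RicciFlatOn (rootDomain n I j a b) L ↔ (∀ ρ ∈ I, deriv a ρ = 0) ∧
      ∃ c : ℝ, (n = 2 ∨ c = 0 ∨ c = -2) ∧ ∀ ρ ∈ I, ρ * deriv b ρ = (2 * j + 4) * c * b ρ := by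
  refine ⟨fun hflat => ⟨fun ρ hρ => h.deriv_a_eq_zero (by omega) hflat hρ, ?_⟩, ?_⟩
  · have h4 : (2 * j : ℝ) + 4 ≠ 0 := by positivity
    -- 2μ + ρμ' = 0 is, up to the factor ρ, the vanishing of (ρ²μ)'; connectedness of I makes ρ²μ a
    -- constant c.
    have hd : ∀ ρ ∈ I, HasDerivAt (fun ρ => ρ ^ 2 * rootMu j b ρ) 0 ρ := fun ρ hρ => by
      have h1 := (hasDerivAt_pow 2 ρ).mul
        (h.differentiableAt_coeff (h.smooth_rootMu (j := j)) hρ).hasDerivAt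
      refine h1.congr_deriv ?_
      push_cast
      linear_combination ρ * (h.rootMu_equations hn hflat hρ).1
    obtain ⟨c, hc⟩ := h.isOpen.exists_is_const_of_deriv_eq_zero hI
      (fun ρ hρ => (hd ρ hρ).differentiableAt.differentiableWithinAt) fun ρ hρ => (hd ρ hρ).deriv
    refine ⟨c, ?_, fun ρ hρ => ?_⟩
    · rcases eq_or_lt_of_le hn with hn | hn
      · exact Or.inl hn.symm
      · right
        obtain ⟨ρ, hρ⟩ := hne
        have h1 := (h.rootMu_equations hn.le hflat hρ).2 hn
        have h2 : c * (c + 2) = 0 := by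
          rw [← hc ρ hρ]
          linear_combination ρ ^ 2 * h1
        rcases mul_eq_zero.1 h2 with h3 | h3
        · exact Or.inl h3
        · exact Or.inr (by linarith)
    · rw [← hc ρ hρ, rootMu]
      have h1 := h.b_ne ρ hρ
      have h2 : ρ ≠ 0 := (h.subset_Ioi hρ).ne'
      field_simp
  · rintro ⟨ha, c, hc, hb⟩
    exact h.ricciFlat_of_log_deriv ha hc hb

lemma ricciFlat_iff_of_eq_one (hn : n = 1) :
    RicciFlatOn (rootDomain n I j a b) L ↔ ∀ ρ ∈ I, deriv a ρ = 0 :=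
  ⟨fun hflat _ hρ => h.deriv_a_eq_zero hn.ge hflat hρ, h.ricciFlat_of_deriv_a_eq_zero hn⟩

end IsRootMetric

/-! ### Signature -/

lemma toQuadraticForm'_eq (M : Matrix (Fin (n + 1)) (Fin (n + 1)) ℝ) (v : Coord n) :
    M.toQuadraticForm' v = v ⬝ᵥ M.mulVec v := by
  simp [Matrix.toQuadraticForm', Matrix.toLinearMap₂'_apply']

lemma radical_toQuadraticForm'_eq_bot {M : Matrix (Fin (n + 1)) (Fin (n + 1)) ℝ} (hs : M.IsSymm)
    (hM : ∀ v : Coord n, M.mulVec v = 0 → v = 0) : M.toQuadraticForm'.radical = ⊥ := by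
  rw [eq_bot_iff]
  intro v hv
  rw [QuadraticMap.mem_radical_iff'] at hv
  obtain ⟨h1, h2⟩ := hv
  have h3 : ∀ w : Coord n, w ⬝ᵥ M.mulVec v = 0 := fun w => by
    have h4 := h2 w
    have h5 : v ⬝ᵥ M.mulVec w = w ⬝ᵥ M.mulVec v := by
      rw [Matrix.dotProduct_mulVec, ← Matrix.mulVec_transpose, hs.eq, dotProduct_comm]
    rw [toQuadraticForm'_eq] at h1
    simp only [toQuadraticForm'_eq, Matrix.mulVec_add, dotProduct_add, add_dotProduct, h1,
      h5] at h4
    linarith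
  exact hM v (dotProduct_eq_zero_iff.1 fun w => by rw [dotProduct_comm]; exact h3 w)

/-- The kernel of f has dimension at least n, which bounds the positive index by 1; the line through
v bounds the negative index by n. Nondegeneracy makes the two indices add up to n + 1, so both
bounds are attained. Weak inequalities therefore suffice. -/
lemma sig_eq_of_nonneg_of_nonpos {M : Matrix (Fin (n + 1)) (Fin (n + 1)) ℝ} (hs : M.IsSymm)
    (hM : ∀ v : Coord n, M.mulVec v = 0 → v = 0) {v : Coord n} (hv : v ≠ 0)
    (hv' : 0 ≤ v ⬝ᵥ M.mulVec v) (f : Coord n →ₗ[ℝ] ℝ)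
    (hf : ∀ w, f w = 0 → w ⬝ᵥ M.mulVec w ≤ 0) :
    sigPos M.toQuadraticForm' = 1 ∧ sigNeg M.toQuadraticForm' = n := by
  have h1 := QuadraticForm.sigPos_add_sigNeg_add_radical (Q := M.toQuadraticForm')
  rw [radical_toQuadraticForm'_eq_bot hs hM, finrank_bot] at h1
  have h2 := QuadraticForm.sigPos_add_finrank_le_of_nonpos (Q := M.toQuadraticForm')
    (V := LinearMap.ker f) fun w hw => by
      rw [toQuadraticForm'_eq]
      exact hf w hw
  have h3 := f.finrank_range_add_finrank_ker
  have h4 : Module.finrank ℝ (LinearMap.range f) ≤ 1 := by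
    simpa using Submodule.finrank_le (LinearMap.range f)
  have h5 := QuadraticForm.sigPos_add_finrank_le_of_nonpos (Q := -M.toQuadraticForm')
    (V := Submodule.span ℝ {v}) fun w hw => by
      obtain ⟨c, rfl⟩ := Submodule.mem_span_singleton.1 hw
      rw [neg_apply, QuadraticMap.map_smul, toQuadraticForm'_eq]
      have := mul_nonneg (mul_self_nonneg c) hv'
      simpa using this
  rw [finrank_span_singleton hv, sigPos_neg] at h5
  have h6 : Module.finrank ℝ (Coord n) = n + 1 := by simp
  have h1' : sigPos M.toQuadraticForm' + sigNeg M.toQuadraticForm' + 0 = n + 1 := h1.trans h6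
  have h2' : sigPos M.toQuadraticForm' + Module.finrank ℝ (LinearMap.ker f) ≤ n + 1 :=
    h2.trans h6.le
  have h3' : Module.finrank ℝ (LinearMap.range f) + Module.finrank ℝ (LinearMap.ker f) = n + 1 :=
    h3.trans h6
  have h5' : sigNeg M.toQuadraticForm' + 1 ≤ n + 1 := h5.trans h6.le
  omega

lemma sdot_sq_le (v w : Coord n) : sdot v w ^ 2 ≤ sdot v v * sdot w w := by
  have := Finset.sum_mul_sq_le_sq_mul_sq Finset.univ (fun i : Fin n => v i.succ)
    fun i : Fin n => w i.succ
  simpa [sdot, pow_two] using this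

namespace IsRootMetric
variable (h : IsRootMetric I j a b L)
  {x y : Coord n} (hp : (x, y) ∈ rootDomain n I j a b)
include h hp

-- Completing squares in the logarithmic coordinates p = v⁰/y⁰ and r = ⟨y, v⟩/N, with S = H₁ + H₂.
-- The last term is the Cauchy–Schwarz defect, which sees only the part of v̄ orthogonal to ȳ, and
-- it has the sign of b.
omit h in
lemma rootForm_eq_sum_squares (v : Coord n) {H₁ H₂ p r : ℝ}
    (h1 : H₁ = a (spatialNorm x) * y 0 ^ (2 * j + 4))
    (h2 : H₂ = b (spatialNorm x) * sdot y y ^ (j + 2)) (hv : p = v 0 / y 0)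
    (hr : r = sdot y v / sdot y y) :
    rootForm j a b x y v v = (j + 2) * rootTheta j a b x y *
      ((H₁ * p + H₂ * r) ^ 2 / (H₁ + H₂) + (2 * j + 3) * (H₁ * H₂ * (p - r) ^ 2 / (H₁ + H₂))
        + b (spatialNorm x) * sdot y y ^ j * (sdot v v * sdot y y - sdot y v ^ 2)) := by
  have hu := hp.2.1
  have hN := hp.2.2.1
  have hS := hp.2.2.2
  have e : rootS j a b x y = H₁ + H₂ := by rw [rootS, h1, h2]
  have e0 : v 0 = p * y 0 := by rw [hv]; field_simp
  have e1 : sdot y v = r * sdot y y := by rw [hr]; field_simp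
  have h4 : (2 * j : ℝ) + 4 ≠ 0 := by positivity
  have e2 : rootSY j a b x y v = (2 * j + 4) * (H₁ * p + H₂ * r) := by
    rw [rootSY, e0, e1, h1, h2]; ring
  have e3 : rootSYY j a b x y v v = (2 * j + 4) * ((2 * j + 3) * H₁ * p ^ 2
      + (2 * j + 3) * H₂ * r ^ 2
      + b (spatialNorm x) * sdot y y ^ j * (sdot v v * sdot y y - sdot y v ^ 2)) := by
    rw [rootSYY, e0, e1, h1, h2]; ring
  replace hS : H₁ + H₂ ≠ 0 := e ▸ hS
  rw [rootForm, e2, e3, e]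
  generalize b (spatialNorm x) * sdot y y ^ j * (sdot v v * sdot y y - sdot y v ^ 2) = X
  field_simp
  ring

lemma rootForm_nonneg (hb : 0 < b (spatialNorm x)) (v : Coord n) :
    0 ≤ rootForm j a b x y v v := by
  have hu := hp.2.1
  have hN := sdot_self_pos hp
  have ha := h.a_pos _ hp.1
  have hθ := rootTheta_pos hp.2.2.2
  have h1 : 0 < a (spatialNorm x) * y 0 ^ (2 * j + 4) :=
    mul_pos ha (Even.pow_pos ⟨j + 2, by ring⟩ hu)
  have h2 : 0 < b (spatialNorm x) * sdot y y ^ (j + 2) := by positivity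
  rw [rootForm_eq_sum_squares hp v rfl rfl rfl rfl]
  have hc : 0 ≤ sdot v v * sdot y y - sdot y v ^ 2 := by
    have := sdot_sq_le y v
    linarith [mul_comm (sdot v v) (sdot y y)]
  positivity

lemma posDef_fundTensor (hb : 0 < b (spatialNorm x)) : (fundTensor L x y).PosDef := by
  have hs := h.isSymm_fundTensor hp
  have h1 : (fundTensor L x y).PosSemidef :=
    .of_dotProduct_mulVec_nonneg (by rw [Matrix.IsHermitian, Matrix.conjTranspose_eq_transpose_of_trivial]; exact hs) fun v => by
      rw [star_trivial, h.dotProduct_fundTensor_mulVec hp]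
      exact h.rootForm_nonneg hp hb v
  exact h1.posDef_iff_isUnit.2 ((Matrix.isUnit_iff_isUnit_det _).2 (h.isUnit_det_fundTensor hp))

lemma sig_fundTensor (hb : b (spatialNorm x) < 0) :
    sigPos (fundTensor L x y).toQuadraticForm' = 1 ∧
      sigNeg (fundTensor L x y).toQuadraticForm' = n := by
  have hu := hp.2.1
  have hN := sdot_self_pos hp
  have ha := h.a_pos _ hp.1
  have hθ := rootTheta_pos hp.2.2.2
  have hS := hp.2.2.2
  obtain ⟨H₁, h1⟩ : ∃ H₁, H₁ = a (spatialNorm x) * y 0 ^ (2 * j + 4) := ⟨_, rfl⟩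
  obtain ⟨H₂, h2⟩ : ∃ H₂, H₂ = b (spatialNorm x) * sdot y y ^ (j + 2) := ⟨_, rfl⟩
  have h1' : 0 < H₁ := h1 ▸ mul_pos ha (Even.pow_pos ⟨j + 2, by ring⟩ hu)
  have h2' : H₂ < 0 := h2 ▸ mul_neg_of_neg_of_pos hb (by positivity)
  replace hS : H₁ + H₂ ≠ 0 := by rw [h1, h2]; exact hS
  have hq := fun v => rootForm_eq_sum_squares hp v h1 h2 rfl rfl
  have hX : ∀ v, b (spatialNorm x) * sdot y y ^ j * (sdot v v * sdot y y - sdot y v ^ 2) ≤ 0 :=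
    fun v => by
      have := sdot_sq_le y v
      exact mul_nonpos_of_nonpos_of_nonneg
        (mul_nonpos_of_nonpos_of_nonneg hb.le (by positivity))
        (by linarith [mul_comm (sdot v v) (sdot y y)])
  have hM := fun v => h.eq_zero_of_mulVec_eq_zero hp (v := v)
  let f₀ : Coord n →ₗ[ℝ] ℝ := LinearMap.proj 0
  let f₁ : Coord n →ₗ[ℝ] ℝ :=
    { toFun := sdot y, map_add' := fun v w => sdot_add_right v w y,
      map_smul' := fun c v => sdot_smul_right c y v }
  -- H₁ > 0 > H₂, so exactly one of the two squares is positive: the (p − r)² term if S < 0, the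
  -- (H₁p + H₂r)² term if S > 0. In the first case v = (H₂y⁰, −H₁ȳ) annihilates the other square and
  -- the defect, and f = p − r is the linear form defining the hyperplane.
  rcases lt_or_gt_of_ne hS with hS' | hS'
  · have e0 : ((H₁ + H₂) • (y 0 • std 0) - H₁ • y : Coord n) 0 = H₂ * y 0 := by
      simp
      ring
    have es : ∀ w, sdot w ((H₁ + H₂) • (y 0 • std 0) - H₁ • y) = -H₁ * sdot w y := fun w => by
      rw [sub_eq_add_neg, ← neg_smul, sdot_add_right, sdot_smul_right, sdot_smul_right,
        sdot_smul_right, sdot_std_zero]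
      ring
    have e1 := es y
    have e2 : sdot ((H₁ + H₂) • (y 0 • std 0) - H₁ • y) ((H₁ + H₂) • (y 0 • std 0) - H₁ • y)
        = H₁ ^ 2 * sdot y y := by
      rw [es, sdot_comm, es]
      ring
    refine sig_eq_of_nonneg_of_nonpos (h.isSymm_fundTensor hp) hM
      (v := (H₁ + H₂) • (y 0 • std 0) - H₁ • y) ?_ ?_ ((y 0)⁻¹ • f₀ - (sdot y y)⁻¹ • f₁) ?_
    · intro hv
      have := congrFun hv 0
      rw [e0] at this
      exact mul_ne_zero h2'.ne hu this
    · rw [h.dotProduct_fundTensor_mulVec hp, hq, e0, e1, e2]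
      have e3 : H₁ * (H₂ * y 0 / y 0) + H₂ * (-H₁ * sdot y y / sdot y y) = 0 := by
        field_simp
        ring
      have e4 : H₁ ^ 2 * sdot y y * sdot y y - (-H₁ * sdot y y) ^ 2 = 0 := by ring
      rw [e3, e4]
      have := div_nonneg_of_nonpos (mul_nonpos_of_nonpos_of_nonneg
        (mul_neg_of_pos_of_neg h1' h2').le
          (sq_nonneg (H₂ * y 0 / y 0 - -H₁ * sdot y y / sdot y y))) hS'.le
      simp only [ne_eq, OfNat.ofNat_ne_zero, not_false_eq_true, zero_pow, mul_zero, zero_div,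
        zero_add, add_zero]
      positivity
    · intro w hw
      rw [h.dotProduct_fundTensor_mulVec hp, hq]
      have hw' : w 0 / y 0 - sdot y w / sdot y y = 0 := by
        rw [← hw]
        simp [f₀, f₁, div_eq_inv_mul]
      rw [hw']
      refine mul_nonpos_of_nonneg_of_nonpos (by positivity) ?_
      have := div_nonpos_of_nonneg_of_nonpos
        (sq_nonneg (H₁ * (w 0 / y 0) + H₂ * (sdot y w / sdot y y))) hS'.le
      have := hX w
      simp only [ne_eq, OfNat.ofNat_ne_zero, not_false_eq_true, zero_pow, mul_zero, zero_div]
      linarith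
  -- For S > 0, y itself is a positive vector, and its orthogonal hyperplane is H₁p + H₂r = 0.
  · refine sig_eq_of_nonneg_of_nonpos (h.isSymm_fundTensor hp) hM
      (v := y) (fun hy => hu (by rw [hy]; rfl)) ?_ ((H₁ / y 0) • f₀ + (H₂ / sdot y y) • f₁) ?_
    · rw [h.dotProduct_fundTensor_mulVec hp, rootForm_self hp.2.2.2, rootSY_self, rootS, ← h1,
        ← h2]
      positivity
    · intro w hw
      rw [h.dotProduct_fundTensor_mulVec hp, hq]
      have hw' : H₁ * (w 0 / y 0) + H₂ * (sdot y w / sdot y y) = 0 := by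
        rw [← hw]
        simp [f₀, f₁]
        ring
      rw [hw']
      refine mul_nonpos_of_nonneg_of_nonpos (by positivity) ?_
      have h5 := div_nonpos_of_nonpos_of_nonneg (mul_nonpos_of_nonpos_of_nonneg
        (mul_neg_of_pos_of_neg h1' h2').le
          (sq_nonneg (w 0 / y 0 - sdot y w / sdot y y))) hS'.le
      have h6 := mul_nonpos_of_nonneg_of_nonpos (by positivity : (0 : ℝ) ≤ 2 * j + 3) h5
      have := hX w
      simp only [ne_eq, OfNat.ofNat_ne_zero, not_false_eq_true, zero_pow, zero_div]
      linarith

end IsRootMetric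

/-! ### The metric is nowhere Riemannian -/

/-- With S = Ar^m + B, a vanishing derivative forces S = 2B. If this held near u, then S would be
locally constant, which A ≠ 0 and u ≠ 0 exclude. -/
lemma not_eventually_const_rpow_mul_pow {j : ℕ} {A B u C : ℝ} (hA : A ≠ 0) (hu : u ≠ 0)
    (hS : A * u ^ (2 * j + 4) + B ≠ 0) :
    ¬ ∀ᶠ r in 𝓝 u, |A * r ^ (2 * j + 4) + B| ^ (((j : ℝ) + 2)⁻¹ - 1) * r ^ (2 * j + 3)
      / (A * r ^ (2 * j + 4) + B) = C := by
  intro hc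
  have hS' : ∀ᶠ r in 𝓝 u, A * r ^ (2 * j + 4) + B ≠ 0 :=
    (Continuous.continuousAt (by fun_prop)).eventually_ne hS
  have hu' : ∀ᶠ r in 𝓝 u, r ≠ 0 := eventually_ne_nhds hu
  have hd : ∀ r, HasDerivAt (fun r : ℝ => A * r ^ (2 * j + 4) + B)
      (A * ((2 * j + 4) * r ^ (2 * j + 3))) r := fun r => by
    have := ((hasDerivAt_pow (2 * j + 4) r).const_mul A).add_const B
    simpa using this
  have h1 : ∀ᶠ r in 𝓝 u, A * r ^ (2 * j + 4) + B - 2 * B = 0 := by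
    filter_upwards [hc.eventually_nhds, hS', hu'] with r hr hSr hr0
    have d1 := (hasDerivAt_abs_rpow (((j : ℝ) + 2)⁻¹ - 1) hSr).comp r (hd r)
    have d2 := (d1.mul (hasDerivAt_pow (2 * j + 3) r)).div (hd r) hSr
    have d3 : HasDerivAt (fun r => |A * r ^ (2 * j + 4) + B| ^ (((j : ℝ) + 2)⁻¹ - 1)
        * r ^ (2 * j + 3) / (A * r ^ (2 * j + 4) + B)) 0 r :=
      (hasDerivAt_const r C).congr_of_eventuallyEq hr
    have d4 := d3.unique d2
    have hθ : |A * r ^ (2 * j + 4) + B| ^ (((j : ℝ) + 2)⁻¹ - 1) ≠ 0 :=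
      (Real.rpow_pos_of_pos (abs_pos.2 hSr) _).ne'
    simp only [Function.comp, Pi.mul_apply] at d4
    have hj : (j : ℝ) + 2 ≠ 0 := by positivity
    have hj' : (2 * j : ℝ) + 3 ≠ 0 := by positivity
    generalize hT : |A * r ^ (2 * j + 4) + B| ^ (((j : ℝ) + 2)⁻¹ - 1) = T at d4 hθ
    have e : ((j : ℝ) + 2)⁻¹ - 1 = -(j + 1) / (j + 2) := by field_simp; ring
    rw [e] at d4
    have d5 : T * r ^ (2 * j + 2) * (2 * j + 3) * (A * r ^ (2 * j + 4) + B - 2 * B) = 0 := by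
      have d6 := (div_eq_zero_iff.1 d4.symm).resolve_right (pow_ne_zero 2 hSr)
      push_cast at d6
      field_simp at d6
      refine (mul_eq_zero.1 (?_ : ((j : ℝ) + 2) * _ = 0)).resolve_left hj
      linear_combination -d6
    have h6 : T * r ^ (2 * j + 2) * (2 * j + 3) ≠ 0 :=
      mul_ne_zero (mul_ne_zero hθ (pow_ne_zero _ hr0)) hj'
    exact (mul_eq_zero.1 d5).resolve_left h6
  have d1 := (hd u).sub_const (2 * B)
  have d2 : HasDerivAt (fun r : ℝ => A * r ^ (2 * j + 4) + B - 2 * B) 0 u :=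
    (hasDerivAt_const u 0).congr_of_eventuallyEq h1
  have d3 := d1.unique d2
  have hj : (2 * j : ℝ) + 4 ≠ 0 := by positivity
  simp [hA, hu, hj] at d3

namespace IsRootMetric
variable (h : IsRootMetric I j a b L)
include h

/-- Only y⁰ is varied, and a mixed component (0, i) with yⁱ ≠ 0 is watched. There S_YY vanishes, so
the component is a nonzero constant times |S|^{2/m−1}(y⁰)^{m−1}/S; that constant is the denominator
of C below. -/
lemma nonRiemannian : NonRiemannianOn (rootDomain n I j a b) L := by
  rintro ⟨x, y⟩ hp hc
  simp only at hc
  have ha := (h.a_pos _ hp.1).ne'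
  have hb := h.b_ne _ hp.1
  have hN := (sdot_self_pos hp).ne'
  obtain ⟨i, hi⟩ : ∃ i : Fin n, y i.succ ≠ 0 := by
    by_contra! hall
    exact hN (by simp [sdot, hall])
  have h2 : (2 * j : ℝ) + 2 ≠ 0 := by positivity
  have h4 : (2 * j : ℝ) + 4 ≠ 0 := by positivity
  have hj : (j : ℝ) + 2 ≠ 0 := by positivity
  have hpath : Continuous fun r : ℝ => y + (r - y 0) • (std 0 : Coord n) := by fun_prop
  have hpath0 : y + (y 0 - y 0) • (std 0 : Coord n) = y := by simp
  have ht : Filter.Tendsto (fun r : ℝ => y + (r - y 0) • (std 0 : Coord n)) (𝓝 (y 0)) (𝓝 y) := by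
    simpa only [hpath0] using hpath.tendsto (y 0)
  refine not_eventually_const_rpow_mul_pow (j := j) (A := a (spatialNorm x))
    (B := b (spatialNorm x) * sdot y y ^ (j + 2)) (u := y 0)
    (C := fundTensor L x y 0 i.succ / (-(1 / 2 * ((j : ℝ) + 2)⁻¹ * (2 * j + 2) * (2 * j + 4)
      * a (spatialNorm x) * b (spatialNorm x) * sdot y y ^ (j + 1) * y i.succ))) ha hp.2.1
    hp.2.2.2 ?_
  filter_upwards [ht.eventually (eventually_mem_right h.isOpen_domain hp), ht.eventually hc]
    with r hr hr'
  have e0 : (y + (r - y 0) • (std 0 : Coord n)) 0 = r := by simp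
  have es : ∀ w, sdot (y + (r - y 0) • (std 0 : Coord n)) w = sdot y w := fun w => by
    simp [sdot_add_left, sdot_smul_left]
  have eN : sdot (y + (r - y 0) • (std 0 : Coord n)) (y + (r - y 0) • (std 0 : Coord n))
      = sdot y y := by rw [es, sdot_comm, es]
  have h00 : (std 0 : Coord n) i.succ = 0 := by simp
  rw [← hr', h.fundTensor_apply hr, rootForm, rootTheta, rootSYY, rootSY, rootSY, rootS, eN, es,
    es, e0]
  have hS : a (spatialNorm x) * r ^ (2 * j + 4) + b (spatialNorm x) * sdot y y ^ (j + 2) ≠ 0 := by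
    have := hr.2.2.2
    simpa only [rootS, eN, e0] using this
  simp only [sdot_std_zero, sdot_std_succ, std_succ_apply_zero, h00, Pi.single_eq_same]
  generalize |a (spatialNorm x) * r ^ (2 * j + 4) + b (spatialNorm x) * sdot y y ^ (j + 2)|
    ^ (((j : ℝ) + 2)⁻¹ - 1) = T
  field_simp
  ring

end IsRootMetric

/-! ### The ansatz `φ = (a(ρ) z^m + b(ρ))^{2/m}` -/

lemma two_div_cast (j : ℕ) : (2 / ((2 * j + 4 : ℕ) : ℝ)) = ((j : ℝ) + 2)⁻¹ := by
  push_cast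
  field_simp
  ring

lemma spatialNorm_ne_zero_iff (y : Coord n) : spatialNorm y ≠ 0 ↔ sdot y y ≠ 0 := by
  rw [← spatialNorm_sq, Ne, Ne, pow_eq_zero_iff two_ne_zero]

lemma rootS_eq_mul (x : Coord n) {y : Coord n} (hy : spatialNorm y ≠ 0) :
    rootS j a b x y = spatialNorm y ^ (2 * j + 4) *
      (a (spatialNorm x) * (y 0 / spatialNorm y) ^ (2 * j + 4) + b (spatialNorm x)) := by
  rw [rootS, ← spatialNorm_sq, div_pow]
  field_simp
  ring

section Ansatz
variable {φ : ℝ → ℝ → ℝ}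
  (hφ : ∀ z, ∀ ρ ∈ I, φ z ρ = signedPow ((j : ℝ) + 2)⁻¹ (a ρ * z ^ (2 * j + 4) + b ρ))
include hφ

lemma warped_eq {x y : Coord n} (hx : spatialNorm x ∈ I) (hy : spatialNorm y ≠ 0) :
    warped φ x y = signedPow ((j : ℝ) + 2)⁻¹ (rootS j a b x y) := by
  have hy' : 0 < spatialNorm y := (spatialNorm_nonneg y).lt_of_ne' hy
  have e : (spatialNorm y ^ (2 * j + 4)) ^ ((j : ℝ) + 2)⁻¹ = spatialNorm y ^ 2 := by
    rw [show 2 * j + 4 = 2 * (j + 2) by ring, pow_mul]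
    have := Real.pow_rpow_inv_natCast (sq_nonneg (spatialNorm y)) (show j + 2 ≠ 0 by omega)
    push_cast at this
    exact this
  rw [warped, hφ _ _ hx, rootS_eq_mul x hy, signedPow_mul_of_pos (pow_pos hy' _), e]

/-- S = |ȳ|^m (a z^m + b), so φ ≠ 0 and S ≠ 0 agree wherever ȳ ≠ 0. -/
lemma regularDomain_eq : regularDomain n I φ = rootDomain n I j a b := by
  ext ⟨x, y⟩
  simp only [regularDomain, rootDomain, mem_ofPred_eq]
  refine and_congr_right fun hx => and_congr_right fun hu => ?_
  rw [← spatialNorm_ne_zero_iff]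
  refine and_congr_right fun hy => ?_
  have hp : ((j : ℝ) + 2)⁻¹ ≠ 0 := by positivity
  rw [hφ _ _ hx, signedPow_ne_zero_iff hp, rootS_eq_mul x hy, mul_ne_zero_iff,
    and_iff_right (pow_ne_zero _ hy)]

lemma isRootMetric_warped (hI : IsOpen I) (hpos : I ⊆ Ioi 0) (ha : ContDiffOn ℝ ∞ a I)
    (hb : ContDiffOn ℝ ∞ b I) (ha0 : ∀ ρ ∈ I, 0 < a ρ) (hb0 : ∀ ρ ∈ I, b ρ ≠ 0) :
    IsRootMetric I j a b (warped φ : TFun n) where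
  isOpen := hI
  subset_Ioi := hpos
  smooth_a := ha
  smooth_b := hb
  a_pos := ha0
  b_ne := hb0
  eq_pow _ _ hp := warped_eq hφ hp.1 ((spatialNorm_ne_zero_iff _).2 hp.2.2.1)

end Ansatz

lemma regularDomain_cone {φ : ℝ → ℝ → ℝ} {p : Coord n × Coord n} (hp : p ∈ regularDomain n I φ)
    {c : ℝ} (hc : 0 < c) : (p.1, c • p.2) ∈ regularDomain n I φ := by
  obtain ⟨h1, h2, h3, h4⟩ := hp
  refine ⟨h1, ?_, ?_, ?_⟩
  · simpa [hc.ne'] using h2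
  · simpa [spatialNorm_smul hc.le, hc.ne'] using h3
  · simpa [spatialNorm_smul hc.le, mul_div_mul_left _ _ hc.ne'] using h4

lemma warped_smul (φ : ℝ → ℝ → ℝ) (x y : Coord n) {c : ℝ} (hc : 0 < c) :
    warped φ x (c • y) = c ^ 2 * warped φ x y := by
  simp only [warped, spatialNorm_smul hc.le, Pi.smul_apply, smul_eq_mul,
    mul_div_mul_left _ _ hc.ne']
  ring

/-! ### Finsler and Lorentz structures from the sign of b -/

namespace IsRootMetric
variable {φ : ℝ → ℝ → ℝ} (h : IsRootMetric I j a b (warped φ : TFun n))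
  (hD : regularDomain n I φ = rootDomain n I j a b)
include h hD

lemma isHomogeneousOn : IsHomogeneousOn (regularDomain n I φ) (warped φ : TFun n) where
  isOpen := hD ▸ h.isOpen_domain
  smooth := hD ▸ h.smooth
  cone _ hp _ hc := regularDomain_cone hp hc
  homogeneous p _ _ hc := warped_smul φ p.1 p.2 hc

lemma isFinslerOn (hb : ∀ ρ ∈ I, 0 < b ρ) :
    IsFinslerOn (regularDomain n I φ) (warped φ : TFun n) where
  toIsHomogeneousOn := h.isHomogeneousOn hD
  pos p hp := by
    rw [hD] at hp
    have ha := h.a_pos _ hp.1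
    have hb' := hb _ hp.1
    have hN := sdot_self_pos hp
    have hS : 0 < rootS j a b p.1 p.2 := by
      have : 0 < p.2 0 ^ (2 * j + 4) := Even.pow_pos ⟨j + 2, by ring⟩ hp.2.1
      unfold rootS
      positivity
    rw [h.eq_pow _ _ hp, signedPow_of_nonneg (by positivity) hS.le]
    positivity
  posDef p hp := by
    rw [hD] at hp
    exact h.posDef_fundTensor hp (hb _ hp.1)

lemma isLorentzOn (hb : ∀ ρ ∈ I, b ρ < 0) :
    IsLorentzOn (regularDomain n I φ) (warped φ : TFun n) where
  toIsHomogeneousOn := h.isHomogeneousOn hD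
  symm p hp := h.isSymm_fundTensor (hD ▸ hp)
  sigPos_eq p hp := by
    rw [hD] at hp
    exact (h.sig_fundTensor hp (hb _ hp.1)).1
  sigNeg_eq p hp := by
    rw [hD] at hp
    exact (h.sig_fundTensor hp (hb _ hp.1)).2

end IsRootMetric

/-! ### Solving the equations for the coefficients -/

lemma deriv_exp_eq_zero_iff (hI : IsOpen I) (hI' : IsPreconnected I) {f : ℝ → ℝ}
    (hf : ContDiffOn ℝ ∞ f I) :
    (∀ ρ ∈ I, deriv (fun ρ => Real.exp (f ρ)) ρ = 0) ↔ IsConstOn f I := by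
  constructor
  · intro h
    obtain ⟨c, hc⟩ := hI.exists_is_const_of_deriv_eq_zero hI'
      (hf.exp.differentiableOn (by simp)) h
    exact ⟨Real.log c, fun ρ hρ => by rw [← hc ρ hρ, Real.log_exp]⟩
  · rintro ⟨c, hc⟩ ρ hρ
    have : (fun ρ => Real.exp (f ρ)) =ᶠ[𝓝 ρ] fun _ => Real.exp c := by
      filter_upwards [hI.mem_nhds hρ] with r hr
      rw [hc r hr]
    rw [this.deriv_eq, deriv_const]

/-- After division by the nonvanishing exponential, the equation says that g − k log ρ has zero
derivative, hence is constant on the interval. The scalar ε is the sign separating the two ansätze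
and drops out. -/
lemma log_deriv_iff (hI : IsOpen I) (hI' : IsPreconnected I) (hpos : I ⊆ Ioi 0) {g : ℝ → ℝ}
    (hg : ContDiffOn ℝ ∞ g I) {ε : ℝ} (hε : ε ≠ 0) (k : ℝ) :
    (∀ ρ ∈ I, ρ * deriv (fun ρ => ε * Real.exp (g ρ)) ρ = k * (ε * Real.exp (g ρ))) ↔
      ∃ B : ℝ, 0 < B ∧ ∀ ρ ∈ I, g ρ = Real.log (B * ρ ^ k) := by
  have hd : ∀ ρ ∈ I, HasDerivAt g (deriv g ρ) ρ := fun ρ hρ =>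
    ((hg.contDiffAt (hI.mem_nhds hρ)).differentiableAt (by simp)).hasDerivAt
  have h1 : ∀ ρ ∈ I, (ρ * deriv (fun ρ => ε * Real.exp (g ρ)) ρ = k * (ε * Real.exp (g ρ)) ↔
      deriv g ρ - k * ρ⁻¹ = 0) := fun ρ hρ => by
    have hρ0 : ρ ≠ 0 := (hpos hρ).ne'
    rw [((hd ρ hρ).exp.const_mul ε).deriv, ← sub_eq_zero,
      show ρ * (ε * (Real.exp (g ρ) * deriv g ρ)) - k * (ε * Real.exp (g ρ)) =
        (ρ * ε * Real.exp (g ρ)) * (deriv g ρ - k * ρ⁻¹) by field_simp]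
    simp [hρ0, hε, Real.exp_ne_zero]
  have h2 : ∀ ρ ∈ I, HasDerivAt (fun ρ => g ρ - k * Real.log ρ) (deriv g ρ - k * ρ⁻¹) ρ :=
    fun ρ hρ => (hd ρ hρ).sub ((Real.hasDerivAt_log (hpos hρ).ne').const_mul k)
  have h3 : ∀ ρ ∈ I, ∀ B : ℝ, 0 < B → Real.log (B * ρ ^ k) = Real.log B + k * Real.log ρ :=
    fun ρ hρ B hB => by
      rw [Real.log_mul hB.ne' (Real.rpow_pos_of_pos (hpos hρ) k).ne', Real.log_rpow (hpos hρ)]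
  constructor
  · intro h
    obtain ⟨c, hc⟩ := hI.exists_is_const_of_deriv_eq_zero hI'
      (fun ρ hρ => (h2 ρ hρ).differentiableAt.differentiableWithinAt)
      fun ρ hρ => (h2 ρ hρ).deriv.trans ((h1 ρ hρ).1 (h ρ hρ))
    refine ⟨Real.exp c, Real.exp_pos c, fun ρ hρ => ?_⟩
    rw [h3 ρ hρ _ (Real.exp_pos c), Real.log_exp, ← hc ρ hρ]
    ring
  · rintro ⟨B, hB, hgB⟩ ρ hρ
    rw [h1 ρ hρ, ← (h2 ρ hρ).deriv]
    have : (fun ρ => g ρ - k * Real.log ρ) =ᶠ[𝓝 ρ] fun _ => Real.log B := by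
      filter_upwards [hI.mem_nhds hρ] with r hr
      rw [hgB r hr, h3 r hr B hB]
      ring
    rw [this.deriv_eq, deriv_const]

lemma isConstOn_iff_log_rpow_zero {g : ℝ → ℝ} :
    IsConstOn g I ↔ ∃ B : ℝ, 0 < B ∧ ∀ ρ ∈ I, g ρ = Real.log (B * ρ ^ (0 : ℝ)) := by
  constructor
  · rintro ⟨c, hc⟩
    exact ⟨Real.exp c, Real.exp_pos c, fun ρ hρ => by simp [hc ρ hρ]⟩
  · rintro ⟨B, -, hB⟩
    exact ⟨Real.log B, fun ρ hρ => by simp [hB ρ hρ]⟩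

/-- The criteria for Ricci-flatness. -/
lemma IsRootMetric.ricciFlat_criteria {f g : ℝ → ℝ} {ε : ℝ} (hε : ε ≠ 0)
    (h : IsRootMetric I j (fun ρ => Real.exp (f ρ)) (fun ρ => ε * Real.exp (g ρ)) L)
    (hI' : IsPreconnected I) (hne : I.Nonempty)
    (hf : ContDiffOn ℝ ∞ f I) (hg : ContDiffOn ℝ ∞ g I) {D : Set (Coord n × Coord n)}
    (hD : D = rootDomain n I j (fun ρ => Real.exp (f ρ)) fun ρ => ε * Real.exp (g ρ)) :
    (3 ≤ n → (RicciFlatOn D L ↔ IsConstOn f I ∧ (IsConstOn g I ∨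
      ∃ B : ℝ, 0 < B ∧ ∀ ρ ∈ I, g ρ = Real.log (B * ρ ^ (-(2 * (2 * j + 4 : ℕ) : ℤ)))))) ∧
    (n = 2 → (RicciFlatOn D L ↔
      IsConstOn f I ∧ ∃ B C : ℝ, 0 < B ∧ ∀ ρ ∈ I, g ρ = Real.log (B * ρ ^ C))) ∧
    (n = 1 → (RicciFlatOn D L ↔ IsConstOn f I)) := by
  subst hD
  have hk := log_deriv_iff h.isOpen hI' h.subset_Ioi hg hε
  refine ⟨fun hn => ?_, fun hn => ?_, fun hn => ?_⟩
  · rw [h.ricciFlat_iff_of_two_le (by omega) hI' hne, deriv_exp_eq_zero_iff h.isOpen hI' hf]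
    refine and_congr_right fun _ => ?_
    have e : ∀ ρ : ℝ, ρ ^ (-(2 * (2 * j + 4 : ℕ) : ℤ)) = ρ ^ ((2 * j + 4) * (-2) : ℝ) := fun ρ => by
      rw [← Real.rpow_intCast]
      congr 1
      push_cast
      ring
    simp only [e]
    constructor
    -- The exponent of b is k = mc: c = 0 gives constant g and c = −2 gives ρ^{−2m}; the alternative
    -- n = 2 contradicts n ≥ 3.
    · rintro ⟨c, rfl | rfl | rfl, hc⟩
      · omega
      · left
        rw [isConstOn_iff_log_rpow_zero, ← hk]
        simpa using hc
      · right
        rw [← hk]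
        exact hc
    · rintro (hc | hc)
      · rw [isConstOn_iff_log_rpow_zero, ← hk] at hc
        exact ⟨0, by simp, by simpa using hc⟩
      · rw [← hk] at hc
        exact ⟨-2, by simp, hc⟩
  · rw [h.ricciFlat_iff_of_two_le hn.ge hI' hne, deriv_exp_eq_zero_iff h.isOpen hI' hf]
    refine and_congr_right fun _ => ?_
    rw [exists_comm]
    constructor
    · rintro ⟨c, -, hc⟩
      exact ⟨(2 * j + 4) * c, (hk _).1 hc⟩
    · rintro ⟨C, hC⟩
      refine ⟨C / (2 * j + 4), Or.inl hn, ?_⟩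
      rw [mul_div_cancel₀ C (by positivity : (2 * j + 4 : ℝ) ≠ 0)]
      exact (hk C).2 hC
  · rw [h.ricciFlat_iff_of_eq_one hn, deriv_exp_eq_zero_iff h.isOpen hI' hf]

/-- The coefficients `b` of the explicit families satisfy the equations for Ricci-flatness. -/
lemma explicit_families {P : Set ℝ → (ℝ → ℝ) → Prop}
    (hP : ∀ I b, IsOpen I → I ⊆ Ioi 0 → ContDiffOn ℝ ∞ b I → (∀ ρ ∈ I, 0 < b ρ) →
      (n = 1 ∨ ∃ c : ℝ, (n = 2 ∨ c = 0 ∨ c = -2) ∧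
        ∀ ρ ∈ I, ρ * deriv b ρ = (2 * j + 4) * c * b ρ) → P I b) {B : ℝ} (hB : 0 < B) :
    P (Ioi 0) (fun _ => B) ∧
    (3 ≤ n → P (Ioi 0) (fun ρ => B * ρ ^ (-(2 * (2 * j + 4 : ℕ) : ℤ)))) ∧
    (n = 2 → ∀ C : ℝ, P (Ioi 0) (fun ρ => B * ρ ^ C)) ∧
    (n = 1 → ∀ C : ℝ, P {ρ | 0 < ρ ∧ ρ ^ 2 + C ≠ 0}
      (fun ρ => B * |ρ ^ 2 + C| ^ (-((2 * j + 4 : ℕ) : ℤ)))) := by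
  refine ⟨?_, fun _ => ?_, fun hn C => ?_, fun hn C => ?_⟩
  · refine hP _ _ isOpen_Ioi subset_rfl contDiffOn_const (fun _ _ => hB) (Or.inr ⟨0, by simp, ?_⟩)
    simp
  · refine hP _ _ isOpen_Ioi subset_rfl ?_ (fun ρ hρ => ?_) (Or.inr ⟨-2, by simp, fun ρ hρ => ?_⟩)
    · have e : ∀ ρ : ℝ, ρ ^ (-(2 * (2 * j + 4 : ℕ) : ℤ)) = (ρ ^ (2 * (2 * j + 4)))⁻¹ := fun ρ => by
        rw [zpow_neg, ← zpow_natCast]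
        push_cast
        rfl
      simp only [e]
      exact contDiffOn_const.mul (ContDiffOn.inv (by fun_prop) fun ρ hρ =>
        pow_ne_zero _ (mem_Ioi.1 hρ).ne')
    · exact mul_pos hB (zpow_pos hρ _)
    · have hρ0 : ρ ≠ 0 := (mem_Ioi.1 hρ).ne'
      rw [((hasDerivAt_zpow _ ρ (Or.inl hρ0)).const_mul B).deriv, zpow_sub_one₀ hρ0]
      push_cast
      field_simp
  · refine hP _ _ isOpen_Ioi subset_rfl ?_ (fun ρ hρ => ?_)
      (Or.inr ⟨C / (2 * j + 4), Or.inl hn, fun ρ hρ => ?_⟩)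
    · exact fun ρ hρ => (contDiffAt_const.mul
        (contDiffAt_id.rpow_const_of_ne (mem_Ioi.1 hρ).ne')).contDiffWithinAt
    · exact mul_pos hB (Real.rpow_pos_of_pos hρ _)
    · have hρ0 : ρ ≠ 0 := (mem_Ioi.1 hρ).ne'
      rw [((Real.hasDerivAt_rpow_const (Or.inl hρ0)).const_mul B).deriv,
        Real.rpow_sub_one hρ0]
      field_simp
  -- For n = 1 any smooth positive b is admissible. The domain is disconnected when C < 0, which is
  -- harmless because sufficiency is pointwise. Smoothness holds because m is even, so the absolute
  -- value can be dropped.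
  · have hc : Continuous fun ρ : ℝ => ρ ^ 2 + C := by fun_prop
    refine hP _ _ (isOpen_Ioi.inter (isOpen_ne_fun hc continuous_const)) (fun ρ hρ => hρ.1) ?_
      (fun ρ hρ => ?_) (Or.inl hn)
    · have e : ∀ ρ : ℝ, |ρ ^ 2 + C| ^ (-((2 * j + 4 : ℕ) : ℤ)) = ((ρ ^ 2 + C) ^ (2 * j + 4))⁻¹ :=
        fun ρ => by rw [zpow_neg, zpow_natCast, Even.pow_abs ⟨j + 2, by ring⟩]
      simp only [e]
      exact contDiffOn_const.mul (ContDiffOn.inv (by fun_prop) fun ρ hρ => pow_ne_zero _ hρ.2)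
    · exact mul_pos hB (zpow_pos (abs_pos.2 hρ.2) _)

/-! ### Both ansätze as signed powers, and the explicit families -/

lemma rootPhi_eq_signedPow {z ρ : ℝ} (ha : 0 ≤ a ρ) (hb : 0 ≤ b ρ) :
    rootPhi (2 * j + 4) a b z ρ = signedPow ((j : ℝ) + 2)⁻¹ (a ρ * z ^ (2 * j + 4) + b ρ) := by
  have hz : 0 ≤ z ^ (2 * j + 4) := Even.pow_nonneg ⟨j + 2, by ring⟩ z
  rw [rootPhi, two_div_cast, signedPow_of_nonneg (by positivity) (by positivity)]

lemma lorentzPhi_eq_signedPow (z ρ : ℝ) :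
    lorentzPhi (2 * j + 4) a b z ρ =
      signedPow ((j : ℝ) + 2)⁻¹ (a ρ * z ^ (2 * j + 4) + -b ρ) := by
  rw [lorentzPhi, two_div_cast, ← sub_eq_add_neg, signedPow]

lemma IsRootMetric.ricciFlat_of_explicit {A : ℝ} (h : IsRootMetric I j (fun _ => A) b L)
    (hflat : n = 1 ∨ ∃ c : ℝ, (n = 2 ∨ c = 0 ∨ c = -2) ∧
      ∀ ρ ∈ I, ρ * deriv b ρ = (2 * j + 4) * c * b ρ) :
    RicciFlatOn (rootDomain n I j (fun _ => A) b) L := by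
  have ha : ∀ ρ ∈ I, deriv (fun _ : ℝ => A) ρ = 0 := fun ρ _ => deriv_const ρ A
  rcases hflat with hn | ⟨c, hc, hb⟩
  · exact h.ricciFlat_of_deriv_a_eq_zero hn ha
  · exact h.ricciFlat_of_log_deriv ha hc hb

lemma isRicciFlatFinsler_rootPhi {A : ℝ} (hA : 0 < A) (hI : IsOpen I) (hpos : I ⊆ Ioi 0)
    (hb : ContDiffOn ℝ ∞ b I) (hb0 : ∀ ρ ∈ I, 0 < b ρ)
    (hflat : n = 1 ∨ ∃ c : ℝ, (n = 2 ∨ c = 0 ∨ c = -2) ∧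
      ∀ ρ ∈ I, ρ * deriv b ρ = (2 * j + 4) * c * b ρ) :
    IsRicciFlatFinsler n I (rootPhi (2 * j + 4) (fun _ => A) b) := by
  have hφ : ∀ z, ∀ ρ ∈ I, rootPhi (2 * j + 4) (fun _ => A) b z ρ =
      signedPow ((j : ℝ) + 2)⁻¹ (A * z ^ (2 * j + 4) + b ρ) := fun z ρ hρ =>
    rootPhi_eq_signedPow hA.le (hb0 ρ hρ).le
  have h := isRootMetric_warped (n := n) (a := fun _ => A) hφ hI hpos contDiffOn_const hb
    (fun _ _ => hA) fun ρ hρ => (hb0 ρ hρ).ne'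
  have hD := regularDomain_eq (n := n) (a := fun _ => A) hφ
  exact ⟨h.isFinslerOn hD hb0, hD ▸ h.nonRiemannian, hD ▸ h.ricciFlat_of_explicit hflat⟩

lemma isRicciFlatLorentz_lorentzPhi {A : ℝ} (hA : 0 < A) (hI : IsOpen I) (hpos : I ⊆ Ioi 0)
    (hb : ContDiffOn ℝ ∞ b I) (hb0 : ∀ ρ ∈ I, 0 < b ρ)
    (hflat : n = 1 ∨ ∃ c : ℝ, (n = 2 ∨ c = 0 ∨ c = -2) ∧
      ∀ ρ ∈ I, ρ * deriv b ρ = (2 * j + 4) * c * b ρ) :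
    IsRicciFlatLorentz n I (lorentzPhi (2 * j + 4) (fun _ => A) b) := by
  have hφ : ∀ z, ∀ ρ ∈ I, lorentzPhi (2 * j + 4) (fun _ => A) b z ρ =
      signedPow ((j : ℝ) + 2)⁻¹ (A * z ^ (2 * j + 4) + -b ρ) := fun z ρ _ =>
    lorentzPhi_eq_signedPow z ρ
  have h := isRootMetric_warped (n := n) (a := fun _ => A) (b := fun ρ => -b ρ) hφ hI hpos
    contDiffOn_const hb.neg (fun _ _ => hA) fun ρ hρ => (neg_neg_of_pos (hb0 ρ hρ)).ne
  have hD := regularDomain_eq (n := n) (a := fun _ => A) (b := fun ρ => -b ρ) hφ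
  refine ⟨h.isLorentzOn hD fun ρ hρ => neg_neg_of_pos (hb0 ρ hρ), hD ▸ h.nonRiemannian,
    hD ▸ h.ricciFlat_of_explicit (hflat.imp_right ?_)⟩
  rintro ⟨c, hc, hc'⟩
  refine ⟨c, hc, fun ρ hρ => ?_⟩
  rw [deriv.fun_neg]
  linear_combination -hc' ρ hρ

end

end WarpedFinsler

open WarpedFinsler in
theorem mainTheorem2 (n m : ℕ) (hn : 1 ≤ n) (hm : Even m) (hm2 : 2 < m) :
    ((∀ (I : Set ℝ) (f g : ℝ → ℝ), IsOpen I → I.Nonempty → IsPreconnected I → I ⊆ Ioi 0 →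
          ContDiffOn ℝ ∞ f I → ContDiffOn ℝ ∞ g I →
        ∀ φ : ℝ → ℝ → ℝ, φ = rootPhi m (fun ρ => Real.exp (f ρ)) (fun ρ => Real.exp (g ρ)) →
          IsFinslerOn (regularDomain n I φ) (warped φ) ∧
          NonRiemannianOn (regularDomain n I φ) (warped φ) ∧
          (3 ≤ n → (RicciFlatOn (regularDomain n I φ) (warped φ) ↔
            IsConstOn f I ∧ (IsConstOn g I ∨
              ∃ B : ℝ, 0 < B ∧ ∀ ρ ∈ I, g ρ = Real.log (B * ρ ^ (-(2 * m : ℤ)))))) ∧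
          (n = 2 → (RicciFlatOn (regularDomain n I φ) (warped φ) ↔
            IsConstOn f I ∧ ∃ B C : ℝ, 0 < B ∧ ∀ ρ ∈ I, g ρ = Real.log (B * ρ ^ C))) ∧
          (n = 1 → (RicciFlatOn (regularDomain n I φ) (warped φ) ↔ IsConstOn f I))) ∧
      (∀ A B : ℝ, 0 < A → 0 < B →
        IsRicciFlatFinsler n (Ioi 0) (rootPhi m (fun _ => A) (fun _ => B)) ∧
        (3 ≤ n → IsRicciFlatFinsler n (Ioi 0)
          (rootPhi m (fun _ => A) (fun ρ => B * ρ ^ (-(2 * m : ℤ))))) ∧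
        (n = 2 → ∀ C : ℝ, IsRicciFlatFinsler n (Ioi 0)
          (rootPhi m (fun _ => A) (fun ρ => B * ρ ^ C))) ∧
        (n = 1 → ∀ C : ℝ, IsRicciFlatFinsler n {ρ | 0 < ρ ∧ ρ ^ 2 + C ≠ 0}
          (rootPhi m (fun _ => A) (fun ρ => B * |ρ ^ 2 + C| ^ (-(m : ℤ))))))) ∧
    (m % 4 = 2 →
      ((∀ (I : Set ℝ) (f g : ℝ → ℝ), IsOpen I → I.Nonempty → IsPreconnected I → I ⊆ Ioi 0 →
          ContDiffOn ℝ ∞ f I → ContDiffOn ℝ ∞ g I →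
        ∀ φ : ℝ → ℝ → ℝ, φ = lorentzPhi m (fun ρ => Real.exp (f ρ)) (fun ρ => Real.exp (g ρ)) →
          IsLorentzOn (regularDomain n I φ) (warped φ) ∧
          NonRiemannianOn (regularDomain n I φ) (warped φ) ∧
          (3 ≤ n → (RicciFlatOn (regularDomain n I φ) (warped φ) ↔
            IsConstOn f I ∧ (IsConstOn g I ∨
              ∃ B : ℝ, 0 < B ∧ ∀ ρ ∈ I, g ρ = Real.log (B * ρ ^ (-(2 * m : ℤ)))))) ∧
          (n = 2 → (RicciFlatOn (regularDomain n I φ) (warped φ) ↔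
            IsConstOn f I ∧ ∃ B C : ℝ, 0 < B ∧ ∀ ρ ∈ I, g ρ = Real.log (B * ρ ^ C))) ∧
          (n = 1 → (RicciFlatOn (regularDomain n I φ) (warped φ) ↔ IsConstOn f I))) ∧
      (∀ A B : ℝ, 0 < A → 0 < B →
        IsRicciFlatLorentz n (Ioi 0) (lorentzPhi m (fun _ => A) (fun _ => B)) ∧
        (3 ≤ n → IsRicciFlatLorentz n (Ioi 0)
          (lorentzPhi m (fun _ => A) (fun ρ => B * ρ ^ (-(2 * m : ℤ))))) ∧
        (n = 2 → ∀ C : ℝ, IsRicciFlatLorentz n (Ioi 0)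
          (lorentzPhi m (fun _ => A) (fun ρ => B * ρ ^ C))) ∧
        (n = 1 → ∀ C : ℝ, IsRicciFlatLorentz n {ρ | 0 < ρ ∧ ρ ^ 2 + C ≠ 0}
          (lorentzPhi m (fun _ => A) (fun ρ => B * |ρ ^ 2 + C| ^ (-(m : ℤ)))))))) := by
  -- An even m > 2 is at least 4. The offset 4 lets the exponents m − 1, m − 2 and m/2 − 2 be
  -- written without natural-number subtraction.
  obtain ⟨j, rfl⟩ : ∃ j, m = 2 * j + 4 := by
    obtain ⟨k, rfl⟩ := hm
    exact ⟨k - 2, by omega⟩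
  refine ⟨⟨?_, fun A B hA hB => explicit_families (P := fun I b =>
    IsRicciFlatFinsler n I (rootPhi (2 * j + 4) (fun _ => A) b))
      (fun I b hI hpos hb hb0 hflat => isRicciFlatFinsler_rootPhi hA hI hpos hb hb0 hflat) hB⟩,
    fun _ => ⟨?_, fun A B hA hB => explicit_families (P := fun I b =>
    IsRicciFlatLorentz n I (lorentzPhi (2 * j + 4) (fun _ => A) b))
      (fun I b hI hpos hb hb0 hflat => isRicciFlatLorentz_lorentzPhi hA hI hpos hb hb0 hflat) hB⟩⟩
  · intro I f g hI hne hI' hpos hf hg φ hφ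
    have hφ' : ∀ z, ∀ ρ ∈ I, φ z ρ = signedPow ((j : ℝ) + 2)⁻¹
        (Real.exp (f ρ) * z ^ (2 * j + 4) + 1 * Real.exp (g ρ)) := fun z ρ _ => by
      rw [hφ, one_mul]
      exact rootPhi_eq_signedPow (Real.exp_pos _).le (Real.exp_pos _).le
    have h := isRootMetric_warped (n := n) (a := fun ρ => Real.exp (f ρ))
      (b := fun ρ => 1 * Real.exp (g ρ)) hφ' hI hpos hf.exp (contDiffOn_const.mul hg.exp)
      (fun _ _ => Real.exp_pos _) fun _ _ => mul_ne_zero one_ne_zero (Real.exp_ne_zero _)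
    have hD := regularDomain_eq (n := n) (a := fun ρ => Real.exp (f ρ))
      (b := fun ρ => 1 * Real.exp (g ρ)) hφ'
    exact ⟨h.isFinslerOn hD fun _ _ => mul_pos one_pos (Real.exp_pos _), hD ▸ h.nonRiemannian,
      h.ricciFlat_criteria one_ne_zero hI' hne hf hg hD⟩
  · intro I f g hI hne hI' hpos hf hg φ hφ
    -- The Lorentzian case is the same root metric with ε = −1, so b = −e^g < 0.
    have hφ' : ∀ z, ∀ ρ ∈ I, φ z ρ = signedPow ((j : ℝ) + 2)⁻¹
        (Real.exp (f ρ) * z ^ (2 * j + 4) + -1 * Real.exp (g ρ)) := fun z ρ _ => by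
      rw [hφ, neg_one_mul]
      exact lorentzPhi_eq_signedPow z ρ
    have h := isRootMetric_warped (n := n) (a := fun ρ => Real.exp (f ρ))
      (b := fun ρ => -1 * Real.exp (g ρ)) hφ' hI hpos hf.exp (contDiffOn_const.mul hg.exp)
      (fun _ _ => Real.exp_pos _) fun _ _ => mul_ne_zero (by norm_num) (Real.exp_ne_zero _)
    have hD := regularDomain_eq (n := n) (a := fun ρ => Real.exp (f ρ))
      (b := fun ρ => -1 * Real.exp (g ρ)) hφ'
    exact ⟨h.isLorentzOn hD fun _ _ => mul_neg_of_neg_of_pos (by norm_num) (Real.exp_pos _),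
      hD ▸ h.nonRiemannian, h.ricciFlat_criteria (by norm_num) hI' hne hf hg hD⟩
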